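/- A (real, global) projective flow on $\mathbb{R}^3$ is a map $\phi:\mathbb{R}^3\to\mathbb{R}^3$ with $\lim_{t\to 0}\phi(\mathbf{x}t)/t=\mathbf{x}$ and $\frac{1}{t+s}\phi(\mathbf{x}(t+s))=\frac1s\phi\big(\phi(\mathbf{x}t)\frac st\big)$ for all $\mathbf{x}\in\mathbb{R}^3$ and real $s,t$ with $s,t,s+t\neq0$; its vector field is $\frac{d}{dt}\frac{\phi(\mathbf{x}t)}{t}\big|_{t=0}$. The octahedral superflow $\phi_{\mathbb{O}}$ is the projective flow with vector field $$\mathbf{C}(x,y,z)=\Big(\frac{y^3z-yz^3}{x^2+y^2+z^2},\ \frac{z^3x-zx^3}{x^2+y^2+z^2},\ \frac{x^3y-xy^3}{x^2+y^2+z^2}\Big),\qquad \mathbf{C}(0)=0,$$ which exists and is unique. Let $V(x,y,z)$ be its first coordinate, and let $\wp$ be the Weierstrass elliptic function with $\wp'^2=4\wp^3-\frac{16}{27}\wp$; it exists, and its period lattice is a square lattice with generators $2\omega,2\omega i$ for some real $\omega>0$. Put $$K(x,y,z)=-\frac{3x^2(2x^2-y^2-z^2)(x^2-2y^2-2z^2)}{(x^2+y^2+z^2)^3},$$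 $$L(x,y,z)=\frac{x^2(2x^2-y^2-z^2)(x^2-2y^2-2z^2)}{9(x^2+y^2+z^2)^9}\big((y^2+z^2+10x^2)^2-108x^4\big)\big((2y^2+2z^2-7x^2)^2-27x^4\big)^2 .$$ **Theorem.** Let $x,y,z\ge 0$, $y\ge z$, satisfy $$\frac{(x^2+y^2+z^2)^2}{x^4+y^4+z^4}=\frac95,\qquad x^2\ge\frac23(x^2+y^2+z^2),$$ and put $\varsigma=\sqrt{x^2+y^2+z^2}$. Assume that $\varsigma$ is not a period of $\wp$ (so that $\wp(\varsigma)$ is finite). Then $L(x,y,z)\ge0$, $K(x,y,z)\ne\wp(\varsigma)$, and the number $$T=\frac14\left[\frac{\sqrt{L(x,y,z)}+\wp'(\varsigma)}{K(x,y,z)-\wp(\varsigma)}\right]^2-K(x,y,z)-\wp(\varsigma),\qquad \sqrt{L(x,y,z)}\ge0,$$ is real with $12-81T^2\ge0$. Let $J=-108T+12i\sqrt{12-81T^2}$, with non-negative square root. Then $|J|=24\sqrt3$; there is exactly one cube root $J^{1/3}$ with $|\arg(J^{1/3})|\le\frac{\pi}{3}$; and for this cube root the number $\frac{J^{1/3}}{18}+\frac{2}{3J^{1/3}}+\frac13$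 is real and positive, and $$V(x,y,z)=\Big(\frac{J^{1/3}}{18}+\frac{2}{3J^{1/3}}+\frac13\Big)^{1/2}\sqrt{x^2+y^2+z^2}>0,$$ with the positive square root. -/

import Mathlib

open Filter Topology

noncomputable section

/-- A (global, real) projective flow on `ℝ³`: a map `φ` such that `φ(t x) / t → x` as `t → 0`,
and which satisfies the projective translation equation
`φ((t + s) x) / (t + s) = φ(φ(t x) s / t) / s`. -/
structure IsProjectiveFlow (φ : (Fin 3 → ℝ) → (Fin 3 → ℝ)) : Prop where
  init : ∀ p : Fin 3 → ℝ, Tendsto (fun t : ℝ => t⁻¹ • φ (t • p)) (𝓝[≠] 0) (𝓝 p)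
  translation : ∀ (p : Fin 3 → ℝ) (s t : ℝ), s ≠ 0 → t ≠ 0 → t + s ≠ 0 →
    (t + s)⁻¹ • φ ((t + s) • p) = s⁻¹ • φ ((s / t) • φ (t • p))

/-- `X` is the vector field of the projective flow `φ`: the derivative at `t = 0` of
`t ↦ φ(t p) / t` (which has the value `p` at `t = 0`) is `X p`. -/
def HasProjectiveField (φ X : (Fin 3 → ℝ) → (Fin 3 → ℝ)) : Prop :=
  ∀ p : Fin 3 → ℝ,
    HasDerivAt (fun t : ℝ => if t = 0 then p else t⁻¹ • φ (t • p)) (X p) 0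

/-- The vector field of the octahedral superflow (it takes the value `0` at the origin, which is
its continuous extension). -/
def octahedralField (p : Fin 3 → ℝ) : Fin 3 → ℝ :=
  ![(p 1 ^ 3 * p 2 - p 1 * p 2 ^ 3) / (p 0 ^ 2 + p 1 ^ 2 + p 2 ^ 2),
    (p 2 ^ 3 * p 0 - p 2 * p 0 ^ 3) / (p 0 ^ 2 + p 1 ^ 2 + p 2 ^ 2),
    (p 0 ^ 3 * p 1 - p 0 * p 1 ^ 3) / (p 0 ^ 2 + p 1 ^ 2 + p 2 ^ 2)]

/-- `φ` is the octahedral superflow: the projective flow whose vector field is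
`octahedralField`. -/
def IsOctahedralSuperflow (φ : (Fin 3 → ℝ) → (Fin 3 → ℝ)) : Prop :=
  IsProjectiveFlow φ ∧ HasProjectiveField φ octahedralField

/-- The Weierstrass function of the lattice of `Λ` satisfies `℘'² = 4 ℘³ - (16/27) ℘`
(away from its poles). -/
def SatisfiesWeierEq (Λ : PeriodPair) : Prop :=
  ∀ u : ℂ, u ∉ Λ.lattice →
    Λ.derivWeierstrassP u ^ 2 = 4 * Λ.weierstrassP u ^ 3 - 16 / 27 * Λ.weierstrassP u

/-- The rational function `K`. -/
def octK (x y z : ℝ) : ℝ :=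
  -(3 * x ^ 2 * (2 * x ^ 2 - y ^ 2 - z ^ 2) * (x ^ 2 - 2 * y ^ 2 - 2 * z ^ 2)) /
    (x ^ 2 + y ^ 2 + z ^ 2) ^ 3

/-- The rational function `L`. -/
def octL (x y z : ℝ) : ℝ :=
  x ^ 2 * (2 * x ^ 2 - y ^ 2 - z ^ 2) * (x ^ 2 - 2 * y ^ 2 - 2 * z ^ 2) /
      (9 * (x ^ 2 + y ^ 2 + z ^ 2) ^ 9) *
    ((y ^ 2 + z ^ 2 + 10 * x ^ 2) ^ 2 - 108 * x ^ 4) *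
    ((2 * y ^ 2 + 2 * z ^ 2 - 7 * x ^ 2) ^ 2 - 27 * x ^ 4) ^ 2

/-- The Euclidean length `√(x² + y² + z²)`. -/
def octR (x y z : ℝ) : ℝ := √(x ^ 2 + y ^ 2 + z ^ 2)

/-- The function `T`, with `℘` the Weierstrass function of the lattice of `Λ`. -/
def octT (Λ : PeriodPair) (x y z : ℝ) : ℂ :=
  1 / 4 *
      (((√(octL x y z) : ℝ) + Λ.derivWeierstrassP (octR x y z : ℝ)) /
        ((octK x y z : ℝ) - Λ.weierstrassP (octR x y z : ℝ))) ^ 2 -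
    (octK x y z : ℝ) - Λ.weierstrassP (octR x y z : ℝ)

/-- `J = -108 T + 12 i √(12 - 81 T²)` for a real number `T`. -/
def octJ (T : ℝ) : ℂ := -108 * (T : ℂ) + 12 * Complex.I * (√(12 - 81 * T ^ 2) : ℝ)

end

/-! The orbit `t ↦ φ(tp)/t` is an integral curve of the field, with `φ p` at time 1. The field is
homogeneous of degree 2 and preserves `x² + y² + z²` and `x⁴ + y⁴ + z⁴`; rescaling gives a curve
`(a, b, c)` on the unit sphere with quartic invariant `5/9` and `V = ς · a(ς)`.

There `a², b², c²` are the roots of `X(X - 1/3)(X - 2/3) = (abc)²`. The discriminant of this cubic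
has no term linear in `(abc)²`, so `T = -27(abc)²` satisfies `T'² = 4T³ - (16/27)T` (`S_sq`), the
equation of `℘`. With `K = T(0)` and `√L = -T'(0)`, the addition formula `weierstrass_addition`
yields `T(ς)`. It is proved along the real line as the constancy of a rational expression, using
`1/℘` and `℘'/℘²`, which stay regular at the periods. Since `T ≤ 0 < ℘` on the real axis, no
denominator vanishes.

Finally `a(ς)²` is recovered from `T(ς)` as a root of the cubic. As `b²c² ≥ 0` keeps `a²` out of
`(1/3, 2/3)`, the bound `a² ≥ 2/3` persists; this is the root that `cardano_octJ` selects. -/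

/-! ### Global existence and uniqueness for the octahedral field -/

section ODE

open Set Metric
open scoped NNReal

/-- A bounded Lipschitz vector field has global integral curves. -/
theorem exists_global_integralCurve {E : Type*} [NormedAddCommGroup E] [NormedSpace ℝ E]
    [CompleteSpace E] {v : E → E} {K L : ℝ≥0} (hv : LipschitzWith K v) (hb : ∀ x, ‖v x‖ ≤ L)
    (x₀ : E) : ∃ γ : ℝ → E, γ 0 = x₀ ∧ ∀ t, HasDerivAt γ (v (γ t)) t := by
  have hloc : ∀ n : ℕ, ∃ α : ℝ → E, α 0 = x₀ ∧
      ∀ t ∈ Ioo (-((n : ℝ) + 1)) ((n : ℝ) + 1), HasDerivAt α (v (α t)) t := by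
    intro n
    have hn : (0 : ℝ) ≤ (n : ℝ) + 1 := by positivity
    have hpl : IsPicardLindelof (fun _ => v) (tmin := -((n : ℝ) + 1)) (tmax := (n : ℝ) + 1)
        ⟨0, by constructor <;> linarith⟩ x₀ (L * ((n : ℝ≥0) + 1)) 0 L K :=
      { lipschitzOnWith := fun _ _ => hv.lipschitzOnWith
        continuousOn := fun _ _ => continuousOn_const
        norm_le := fun _ _ x _ => hb x
        mul_max_le := by simp }
    obtain ⟨α, h0, hα⟩ := hpl.exists_eq_forall_mem_Icc_hasDerivWithinAt₀
    exact ⟨α, h0, fun t ht => (hα t (Ioo_subset_Icc_self ht)).hasDerivAt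
      (Icc_mem_nhds ht.1 ht.2)⟩
  choose α h0 hα using hloc
  have hagree : ∀ m n : ℕ, m ≤ n → EqOn (α m) (α n) (Ioo (-((m : ℝ) + 1)) ((m : ℝ) + 1)) := by
    intro m n hmn
    have hmn' : (m : ℝ) ≤ n := by exact_mod_cast hmn
    refine ODE_solution_unique_of_mem_Ioo (v := fun _ => v) (s := fun _ => univ) (K := K) (t₀ := 0)
      (fun _ _ => hv.lipschitzOnWith) ?_ (fun t ht => ⟨hα m t ht, mem_univ _⟩)
      (fun t ht => ⟨hα n t ⟨by linarith [ht.1], by linarith [ht.2]⟩, mem_univ _⟩)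
      ((h0 m).trans (h0 n).symm)
    have : (0 : ℝ) ≤ m := by positivity
    constructor <;> linarith
  refine ⟨fun t => α ⌈|t|⌉₊ t, h0 _, fun t => ?_⟩
  have hmem : ∀ s : ℝ, s ∈ Ioo (-((⌈|s|⌉₊ : ℝ) + 1)) ((⌈|s|⌉₊ : ℝ) + 1) := fun s => by
    have := Nat.le_ceil |s|
    constructor <;> linarith [neg_abs_le s, le_abs_self s]
  refine (hα _ t (hmem t)).congr_of_eventuallyEq ?_
  filter_upwards [Ioo_mem_nhds (hmem t).1 (hmem t).2] with s hs
  rcases le_total ⌈|s|⌉₊ ⌈|t|⌉₊ with h | h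
  · exact hagree _ _ h (hmem s)
  · exact (hagree _ _ h hs).symm

/-- The squared Euclidean length of a vector of `ℝ³`. -/
def sqLen (p : Fin 3 → ℝ) : ℝ := p 0 ^ 2 + p 1 ^ 2 + p 2 ^ 2

/-- The numerator of the octahedral vector field. -/
def octNum (p : Fin 3 → ℝ) : Fin 3 → ℝ :=
  ![p 1 ^ 3 * p 2 - p 1 * p 2 ^ 3, p 2 ^ 3 * p 0 - p 2 * p 0 ^ 3, p 0 ^ 3 * p 1 - p 0 * p 1 ^ 3]

theorem octahedralField_eq (p : Fin 3 → ℝ) : octahedralField p = (sqLen p)⁻¹ • octNum p := by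
  ext i
  fin_cases i <;> simp [octahedralField, octNum, sqLen, div_eq_inv_mul]

theorem contDiff_octNum : ContDiff ℝ 1 octNum := by
  rw [contDiff_pi]
  intro i
  fin_cases i <;> simp only [octNum] <;> simp <;> fun_prop

theorem contDiff_sqLen : ContDiff ℝ 1 sqLen := by
  unfold sqLen
  fun_prop

/-- A curve whose velocity is everywhere proportional to `octNum` stays on a sphere. -/
theorem sqLen_eq_of_hasDerivAt {γ : ℝ → Fin 3 → ℝ} {c : ℝ → ℝ}
    (h : ∀ t, HasDerivAt γ (c t • octNum (γ t)) t) (t : ℝ) : sqLen (γ t) = sqLen (γ 0) := by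
  have hd : ∀ t, HasDerivAt (fun t => sqLen (γ t)) 0 t := by
    intro t
    have h' := hasDerivAt_pi.1 (h t)
    have := (((h' 0).pow 2).add ((h' 1).pow 2)).add ((h' 2).pow 2)
    refine this.congr_deriv ?_
    simp [octNum]
    ring
  exact is_const_of_deriv_eq_zero (fun t => (hd t).differentiableAt) (fun t => (hd t).deriv) t 0

theorem norm_le_of_sqLen_le {p : Fin 3 → ℝ} {r : ℝ} (hr : 0 ≤ r) (h : sqLen p ≤ r ^ 2) :
    ‖p‖ ≤ r := by
  rw [pi_norm_le_iff_of_nonneg hr]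
  unfold sqLen at h
  intro i
  refine abs_le_of_sq_le_sq ?_ hr
  fin_cases i <;> simp <;> nlinarith [sq_nonneg (p 0), sq_nonneg (p 1), sq_nonneg (p 2)]

/-- Global existence for the octahedral vector field. -/
theorem exists_octahedral_curve (p : Fin 3 → ℝ) :
    ∃ γ : ℝ → Fin 3 → ℝ, γ 0 = p ∧ ∀ t, HasDerivAt γ (octahedralField (γ t)) t := by
  set ρ := sqLen p with hρ
  have hρ0 : 0 ≤ ρ := by rw [hρ]; unfold sqLen; positivity
  -- Freezing `1/sqLen` at `ρ⁻¹` removes the singularity at the origin. The cutoff keeps the field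
  -- tangent to spheres and equals 1 on the sphere of the initial point. For `ρ = 0` the convention
  -- `0⁻¹ = 0` agrees with the original field.
  let v : (Fin 3 → ℝ) → (Fin 3 → ℝ) := fun q =>
    ((Real.smoothTransition (ρ + 2 - sqLen q) * ρ⁻¹ : ℝ) • octNum q : Fin 3 → ℝ)
  have hv : ContDiff ℝ 1 v := by
    have hs : ContDiff ℝ 1 fun q : Fin 3 → ℝ => Real.smoothTransition (ρ + 2 - sqLen q) :=
      Real.smoothTransition.contDiff.comp (contDiff_const.sub contDiff_sqLen)
    exact (hs.mul contDiff_const).smul contDiff_octNum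
  have hsupp : HasCompactSupport v := by
    refine HasCompactSupport.intro (isCompact_closedBall (0 : Fin 3 → ℝ) (√(ρ + 2))) ?_
    intro q hq
    have : ¬ sqLen q ≤ √(ρ + 2) ^ 2 := fun h => hq (by
      simpa using norm_le_of_sqLen_le (Real.sqrt_nonneg _) h)
    rw [Real.sq_sqrt (by linarith)] at this
    simp only [v]
    rw [Real.smoothTransition.zero_of_nonpos (by linarith)]
    simp
  obtain ⟨K, hK⟩ : ∃ K, LipschitzWith K v :=
    ContDiff.lipschitzWith_of_hasCompactSupport (𝕂 := ℝ) hsupp hv one_ne_zero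
  obtain ⟨L, hL⟩ := hv.continuous.bounded_above_of_compact_support hsupp
  obtain ⟨γ, h0, hγ⟩ := exists_global_integralCurve (L := L.toNNReal) hK
    (fun x => (hL x).trans (Real.le_coe_toNNReal L)) p
  refine ⟨γ, h0, fun t => ?_⟩
  have hc : sqLen (γ t) = ρ := by rw [sqLen_eq_of_hasDerivAt hγ t, h0]
  refine (hγ t).congr_deriv ?_
  rw [octahedralField_eq, hc]
  simp only [v]
  rw [hc, Real.smoothTransition.one_of_one_le (by linarith), one_mul]

/-- Uniqueness for the octahedral vector field. -/
theorem octahedral_curve_unique {γ δ : ℝ → Fin 3 → ℝ}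
    (hγ : ∀ t, HasDerivAt γ (octahedralField (γ t)) t)
    (hδ : ∀ t, HasDerivAt δ (octahedralField (δ t)) t) {t₀ : ℝ} (h : γ t₀ = δ t₀) : γ = δ := by
  simp_rw [octahedralField_eq] at hγ hδ
  have hcγ : ∀ t, sqLen (γ t) = sqLen (γ t₀) := fun t => by
    rw [sqLen_eq_of_hasDerivAt hγ t, sqLen_eq_of_hasDerivAt hγ t₀]
  have hcδ : ∀ t, sqLen (δ t) = sqLen (γ t₀) := fun t => by
    rw [h, sqLen_eq_of_hasDerivAt hδ t, sqLen_eq_of_hasDerivAt hδ t₀]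
  set ρ := sqLen (γ t₀)
  have hρ0 : 0 ≤ ρ := by simp only [ρ]; unfold sqLen; positivity
  have hball : ∀ q, sqLen q = ρ → q ∈ closedBall (0 : Fin 3 → ℝ) (√ρ) := fun q hq => by
    simpa using norm_le_of_sqLen_le (Real.sqrt_nonneg ρ) (by rw [hq, Real.sq_sqrt hρ0])
  have hsm : ContDiff ℝ 1 (fun q => ρ⁻¹ • octNum q) := contDiff_octNum.const_smul _
  obtain ⟨K, hK⟩ : ∃ K, LipschitzOnWith K (fun q => ρ⁻¹ • octNum q) (closedBall 0 (√ρ)) :=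
    hsm.contDiffOn.exists_lipschitzOnWith one_ne_zero (convex_closedBall 0 _)
      (isCompact_closedBall 0 _)
  refine ODE_solution_unique_univ (v := fun _ q => ρ⁻¹ • octNum q)
    (s := fun _ => closedBall 0 (√ρ)) (t₀ := t₀) (fun _ => hK)
    (fun t => ⟨?_, hball _ (hcγ t)⟩) (fun t => ⟨?_, hball _ (hcδ t)⟩) h
  · simpa only [hcγ t] using hγ t
  · simpa only [hcδ t] using hδ t

end ODE

/-! ### Projective flows as flows of homogeneous fields -/

/-- The orbit `t ↦ φ(t p) / t` of a projective flow, with value `p` at `t = 0`. -/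
noncomputable def projOrbit (φ : (Fin 3 → ℝ) → (Fin 3 → ℝ)) (p : Fin 3 → ℝ) (t : ℝ) : Fin 3 → ℝ :=
  if t = 0 then p else t⁻¹ • φ (t • p)

/-- The translation equation says that the orbit of `p` at time `s` is the orbit of `projOrbit φ p
t` at time `s - t`; this carries the derivative at 0 to every `t`. -/
theorem IsOctahedralSuperflow.hasDerivAt_projOrbit {φ : (Fin 3 → ℝ) → (Fin 3 → ℝ)}
    (h : IsOctahedralSuperflow φ) (p : Fin 3 → ℝ) (t : ℝ) :
    HasDerivAt (projOrbit φ p) (octahedralField (projOrbit φ p t)) t := by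
  rcases eq_or_ne t 0 with rfl | ht
  · rw [show projOrbit φ p 0 = p from if_pos rfl]
    exact h.2 p
  · have h1 : HasDerivAt (projOrbit φ (projOrbit φ p t))
        (octahedralField (projOrbit φ p t)) (t - t) := by
      rw [sub_self]
      exact h.2 (projOrbit φ p t)
    have h2 := HasDerivAt.comp_sub_const t t h1
    refine h2.congr_of_eventuallyEq ?_
    filter_upwards [eventually_ne_nhds ht] with s hs
    rcases eq_or_ne s t with rfl | hst
    · simp [projOrbit]
    · have hst' : s - t ≠ 0 := sub_ne_zero.2 hst
      have := h.1.translation p (s - t) t hst' ht (by simpa using hs)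
      simp only [add_sub_cancel] at this
      simp [projOrbit, hs, ht, hst', this, smul_smul, div_eq_mul_inv]

theorem IsOctahedralSuperflow.exists_curve {φ : (Fin 3 → ℝ) → (Fin 3 → ℝ)}
    (h : IsOctahedralSuperflow φ) (p : Fin 3 → ℝ) :
    ∃ γ : ℝ → Fin 3 → ℝ, γ 0 = p ∧ γ 1 = φ p ∧
      ∀ t, HasDerivAt γ (octahedralField (γ t)) t :=
  ⟨projOrbit φ p, by simp [projOrbit], by simp [projOrbit], h.hasDerivAt_projOrbit p⟩

/-- The global flow of the octahedral vector field. -/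
noncomputable def octFlow (p : Fin 3 → ℝ) : ℝ → Fin 3 → ℝ := (exists_octahedral_curve p).choose

theorem octFlow_zero (p : Fin 3 → ℝ) : octFlow p 0 = p := (exists_octahedral_curve p).choose_spec.1

theorem hasDerivAt_octFlow (p : Fin 3 → ℝ) (t : ℝ) :
    HasDerivAt (octFlow p) (octahedralField (octFlow p t)) t :=
  (exists_octahedral_curve p).choose_spec.2 t

theorem octahedralField_smul (c : ℝ) (p : Fin 3 → ℝ) :
    octahedralField (c • p) = c ^ 2 • octahedralField p := by
  rcases eq_or_ne c 0 with rfl | hc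
  · ext i
    fin_cases i <;> simp [octahedralField]
  · have h1 : sqLen (c • p) = c ^ 2 * sqLen p := by simp [sqLen]; ring
    have h2 : octNum (c • p) = c ^ 4 • octNum p := by
      ext i
      fin_cases i <;> simp [octNum] <;> ring
    rw [octahedralField_eq, octahedralField_eq, h1, h2, smul_smul, smul_smul, mul_inv]
    congr 1
    field_simp

theorem hasDerivAt_smul_curve {γ : ℝ → Fin 3 → ℝ}
    (hγ : ∀ t, HasDerivAt γ (octahedralField (γ t)) t) (c t : ℝ) :
    HasDerivAt (fun s => c • γ (c * s)) (octahedralField (c • γ (c * t))) t := by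
  have h1 : HasDerivAt (fun s => γ (c * s)) (c • octahedralField (γ (c * t))) t :=
    (hγ (c * t)).scomp t (by simpa using (hasDerivAt_id t).const_mul c)
  have h2 := h1.const_smul c
  rwa [smul_smul, ← sq, ← octahedralField_smul] at h2

theorem octFlow_smul (c : ℝ) (p : Fin 3 → ℝ) (t : ℝ) :
    octFlow (c • p) t = c • octFlow p (c * t) :=
  congrFun (octahedral_curve_unique (hasDerivAt_octFlow (c • p))
    (hasDerivAt_smul_curve (hasDerivAt_octFlow p) c) (t₀ := 0) (by simp [octFlow_zero])) t

theorem octFlow_octFlow (p : Fin 3 → ℝ) (t s : ℝ) :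
    octFlow (octFlow p t) s = octFlow p (t + s) :=
  congrFun (octahedral_curve_unique (hasDerivAt_octFlow (octFlow p t))
    (fun s => (hasDerivAt_octFlow p (t + s)).comp_const_add t s) (t₀ := 0)
    (by simp [octFlow_zero])) s

theorem inv_smul_octFlow (p : Fin 3 → ℝ) {t : ℝ} (ht : t ≠ 0) :
    t⁻¹ • octFlow (t • p) 1 = octFlow p t := by
  rw [octFlow_smul, smul_smul, inv_mul_cancel₀ ht, one_smul, mul_one]

/-- Homogeneity trades scaling for time (`inv_smul_octFlow`), so the translation equation becomes
the group law of the flow. -/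
theorem isOctahedralSuperflow_octFlow : IsOctahedralSuperflow (fun p => octFlow p 1) := by
  refine ⟨⟨fun p => ?_, fun p s t hs ht hts => ?_⟩, fun p => ?_⟩
  · have h := (hasDerivAt_octFlow p 0).continuousAt.tendsto
    rw [octFlow_zero] at h
    refine (h.mono_left nhdsWithin_le_nhds).congr' ?_
    filter_upwards [self_mem_nhdsWithin] with t ht
    exact (inv_smul_octFlow p ht).symm
  · rw [inv_smul_octFlow p hts, div_eq_mul_inv, mul_smul, inv_smul_octFlow p ht,
      inv_smul_octFlow _ hs, octFlow_octFlow]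
  · have h := hasDerivAt_octFlow p 0
    rw [octFlow_zero] at h
    refine h.congr_of_eventuallyEq (Eventually.of_forall fun t => ?_)
    rcases eq_or_ne t 0 with rfl | ht
    · simp [octFlow_zero]
    · simp [ht, inv_smul_octFlow p ht]

theorem existsUnique_octahedralSuperflow :
    ∃! φ : (Fin 3 → ℝ) → (Fin 3 → ℝ), IsOctahedralSuperflow φ := by
  refine ⟨_, isOctahedralSuperflow_octFlow, fun φ hφ => funext fun p => ?_⟩
  obtain ⟨γ, h0, h1, hγ⟩ := hφ.exists_curve p
  rw [← h1, octahedral_curve_unique hγ (hasDerivAt_octFlow p) (t₀ := 0) (by rw [h0, octFlow_zero])]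

/-! ### Existence of the Weierstrass function on a square lattice -/

/-- The square period pair with periods `c` and `c i`. -/
noncomputable def squarePair (c : ℝ) (hc : 0 < c) : PeriodPair where
  ω₁ := c
  ω₂ := c * Complex.I
  indep := by
    rw [LinearIndependent.pair_iff]
    intro s t h
    have h1 := congrArg Complex.re h
    have h2 := congrArg Complex.im h
    simp at h1 h2
    exact ⟨h1.resolve_right hc.ne', h2.resolve_right hc.ne'⟩

/-- The Eisenstein sum of weight `n` over the Gaussian integers. -/
noncomputable def gaussEisenstein (n : ℕ) : ℂ :=
  ∑' x : ℤ × ℤ, (((x.1 : ℂ) + x.2 * Complex.I) ^ n)⁻¹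

theorem squarePair_summand {c : ℝ} (hc : 0 < c) (n : ℕ) (x : ℤ × ℤ) :
    (((squarePair c hc).latticeEquivProd.symm x : ℂ) ^ n)⁻¹ =
      ((c : ℂ) ^ n)⁻¹ * (((x.1 : ℂ) + x.2 * Complex.I) ^ n)⁻¹ := by
  rw [PeriodPair.latticeEquiv_symm_apply, ← mul_inv, ← mul_pow]
  congr 2
  simp only [squarePair]
  ring

theorem squarePair_G {c : ℝ} (hc : 0 < c) (n : ℕ) :
    (squarePair c hc).G n = ((c : ℂ) ^ n)⁻¹ * gaussEisenstein n := by
  rw [PeriodPair.G, gaussEisenstein, ← tsum_mul_left,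
    ← (squarePair c hc).latticeEquivProd.symm.toEquiv.tsum_eq]
  exact tsum_congr fun x => squarePair_summand hc n x

theorem summable_gaussEisenstein {n : ℕ} (hn : 2 < n) :
    Summable fun x : ℤ × ℤ => (((x.1 : ℂ) + x.2 * Complex.I) ^ n)⁻¹ := by
  have h := ((squarePair 1 one_pos).hasSum_sumInvPow 0 hn).summable
  rw [← (squarePair 1 one_pos).latticeEquivProd.symm.toEquiv.summable_iff] at h
  refine h.congr fun x => ?_
  have := squarePair_summand one_pos n x
  simpa using this

/-- Multiplication by `i` permutes the Gaussian integers, and `i⁶ = -1`. -/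
theorem gaussEisenstein_six : gaussEisenstein 6 = 0 := by
  rw [← CharZero.eq_neg_self_iff]
  let e : ℤ × ℤ ≃ ℤ × ℤ :=
    { toFun := fun x => (-x.2, x.1)
      invFun := fun x => (x.2, -x.1)
      left_inv := fun x => by simp
      right_inv := fun x => by simp }
  conv_lhs => rw [gaussEisenstein, ← e.tsum_eq]
  rw [gaussEisenstein, ← tsum_neg]
  refine tsum_congr fun x => ?_
  have : (((e x).1 : ℂ) + (e x).2 * Complex.I) = Complex.I * ((x.1 : ℂ) + x.2 * Complex.I) := by
    simp [e]
    linear_combination (-(x.2 : ℂ)) * Complex.I_sq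
  rw [this, mul_pow, show Complex.I ^ 6 = -1 by
    rw [show 6 = 2 * 3 by rfl, pow_mul, Complex.I_sq]; norm_num, neg_one_mul, inv_neg]

theorem gaussEisenstein_four_im : (gaussEisenstein 4).im = 0 := by
  rw [← Complex.conj_eq_iff_im, gaussEisenstein, Complex.conj_tsum,
    ← ((Equiv.refl ℤ).prodCongr (Equiv.neg ℤ)).tsum_eq]
  refine tsum_congr fun x => ?_
  simp

theorem hasSum_int_of_even {f : ℤ → ℝ} {a : ℝ} (h : HasSum (fun n : ℕ => f n) a)
    (hf : ∀ n, f (-n) = f n) (h0 : f 0 = 0) : HasSum f (2 * a) := by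
  have := HasSum.of_nat_of_neg h (by simpa only [hf] using h)
  rwa [h0, sub_zero, ← two_mul] at this

/-- Terms on the axes are exact; off the axes the modulus `1/(m² + n²)²` is at most `1/(4m²n²)`.
Since `1/0 = 0`, one formula covers all cases, and its sum is a combination of products of zeta
values. -/
theorem re_inv_gauss_pow_four_ge (m n : ℤ) :
    (1 / (m : ℝ) ^ 4 * (if n = 0 then 1 else 0) + (if m = 0 then 1 else 0) * (1 / (n : ℝ) ^ 4)) -
      1 / 4 * (1 / (m : ℝ) ^ 2 * (1 / (n : ℝ) ^ 2)) ≤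
    ((((m : ℂ) + n * Complex.I) ^ 4)⁻¹).re := by
  rcases eq_or_ne m 0 with rfl | hm
  · rcases eq_or_ne n 0 with rfl | hn
    · simp
    · have : ((n : ℂ) * Complex.I) ^ 4 = (((n : ℝ) ^ 4 : ℝ) : ℂ) := by
        rw [mul_pow, Complex.I_pow_four]; push_cast; ring
      simp only [Int.cast_zero, zero_add, this, ← Complex.ofReal_inv, Complex.ofReal_re]
      simp [hn]
  rcases eq_or_ne n 0 with rfl | hn
  · have : ((m : ℂ)) ^ 4 = (((m : ℝ) ^ 4 : ℝ) : ℂ) := by push_cast; ring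
    simp only [Int.cast_zero, zero_mul, add_zero, this, ← Complex.ofReal_inv, Complex.ofReal_re]
    simp [hm]
  have hm' : (0 : ℝ) < (m : ℝ) ^ 2 := by positivity
  have hn' : (0 : ℝ) < (n : ℝ) ^ 2 := by positivity
  have h1 := (abs_le.1 (Complex.abs_re_le_norm ((((m : ℂ) + n * Complex.I) ^ 4)⁻¹))).1
  have h2 : ‖((((m : ℂ) + n * Complex.I) ^ 4)⁻¹)‖ = (((m : ℝ) ^ 2 + (n : ℝ) ^ 2) ^ 2)⁻¹ := by
    rw [norm_inv, norm_pow, show 4 = 2 * 2 by rfl, pow_mul, ← Complex.normSq_eq_norm_sq]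
    simp [Complex.normSq_apply, sq]
  have h3 : (((m : ℝ) ^ 2 + (n : ℝ) ^ 2) ^ 2)⁻¹ ≤ (4 * ((m : ℝ) ^ 2 * (n : ℝ) ^ 2))⁻¹ := by
    refine inv_anti₀ (by positivity) ?_
    nlinarith [sq_nonneg ((m : ℝ) ^ 2 - (n : ℝ) ^ 2)]
  have h4 : 1 / 4 * (1 / (m : ℝ) ^ 2 * (1 / (n : ℝ) ^ 2)) = (4 * ((m : ℝ) ^ 2 * (n : ℝ) ^ 2))⁻¹ := by
    field_simp
  rw [h4, if_neg hm, if_neg hn]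
  rw [h2] at h1
  linarith

theorem gaussEisenstein_four_re_pos : 0 < (gaussEisenstein 4).re := by
  have h2 : HasSum (fun m : ℤ => 1 / (m : ℝ) ^ 2) (2 * (Real.pi ^ 2 / 6)) :=
    hasSum_int_of_even (by simpa only [Int.cast_natCast] using hasSum_zeta_two) (by simp) (by simp)
  have h4 : HasSum (fun m : ℤ => 1 / (m : ℝ) ^ 4) (2 * (Real.pi ^ 4 / 90)) :=
    hasSum_int_of_even (by simpa only [Int.cast_natCast] using hasSum_zeta_four) (fun n => by
        push_cast; rw [Even.neg_pow (by decide)])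
      (by simp)
  have hδ : HasSum (fun m : ℤ => if m = 0 then (1 : ℝ) else 0) 1 := hasSum_ite_eq 0 1
  have hprod : ∀ {f g : ℤ → ℝ} {a b : ℝ}, HasSum f a → HasSum g b → (∀ m, 0 ≤ f m) →
      (∀ m, 0 ≤ g m) → HasSum (fun x : ℤ × ℤ => f x.1 * g x.2) (a * b) := fun hf hg h0 h1 =>
    hf.mul hg (hf.summable.mul_of_nonneg hg.summable h0 h1)
  have n2 : ∀ m : ℤ, 0 ≤ 1 / (m : ℝ) ^ 2 := fun m => by positivity
  have n4 : ∀ m : ℤ, 0 ≤ 1 / (m : ℝ) ^ 4 := fun m => by positivity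
  have nδ : ∀ m : ℤ, (0 : ℝ) ≤ if m = 0 then (1 : ℝ) else 0 := fun m => by split_ifs <;> norm_num
  have H := ((hprod h4 hδ n4 nδ).add (hprod hδ h4 nδ n4)).sub ((hprod h2 h2 n2 n2).mul_left (1 / 4))
  have H' : HasSum (fun x : ℤ × ℤ => ((((x.1 : ℂ) + x.2 * Complex.I) ^ 4)⁻¹).re)
      (gaussEisenstein 4).re := Complex.hasSum_re (summable_gaussEisenstein (n := 4) (by norm_num)).hasSum
  refine lt_of_lt_of_le ?_ (hasSum_le (fun x => ?_) H H')
  swap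
  · exact re_inv_gauss_pow_four_ge x.1 x.2
  have hπ : 0 < Real.pi ^ 4 := by positivity
  -- The lower bound is `4ζ(4) - ζ(2)²`.
  have : 2 * (Real.pi ^ 4 / 90) * 1 + 1 * (2 * (Real.pi ^ 4 / 90)) -
      1 / 4 * (2 * (Real.pi ^ 2 / 6) * (2 * (Real.pi ^ 2 / 6))) = Real.pi ^ 4 / 60 := by ring
  rw [this]
  positivity

theorem exists_square_weierstrass :
    ∃ (ω : ℝ) (Λ : PeriodPair), 0 < ω ∧ Λ.ω₁ = 2 * (ω : ℂ) ∧ Λ.ω₂ = 2 * (ω : ℂ) * Complex.I ∧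
      SatisfiesWeierEq Λ := by
  set S := (gaussEisenstein 4).re with hS
  have hSpos : 0 < S := gaussEisenstein_four_re_pos
  have hS4 : gaussEisenstein 4 = (S : ℂ) :=
    Complex.ext (by simp [hS]) (by simp [gaussEisenstein_four_im])
  -- Chosen so that `g₂ = 60 S / c⁴ = 16/27`.
  set c := √√(405 / 4 * S) with hc
  have hcpos : 0 < c := by positivity
  have hc4 : c ^ 4 = 405 / 4 * S := by
    rw [show 4 = 2 * 2 by rfl, pow_mul, hc, Real.sq_sqrt (by positivity),
      Real.sq_sqrt (by positivity)]
  refine ⟨c / 2, squarePair c hcpos, by positivity, ?_, ?_, fun u hu => ?_⟩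
  · simp only [squarePair]; push_cast; ring
  · simp only [squarePair]; push_cast; ring
  · have hc4' : (c : ℂ) ^ 4 = 405 / 4 * (S : ℂ) := by
      rw [← Complex.ofReal_pow, hc4]; push_cast; ring
    have hSne : (S : ℂ) ≠ 0 := by exact_mod_cast hSpos.ne'
    rw [PeriodPair.derivWeierstrassP_sq _ _ hu, PeriodPair.g₂, PeriodPair.g₃, squarePair_G,
      squarePair_G, gaussEisenstein_six, hS4, hc4']
    field_simp
    ring

/-! ### Derivatives of `℘` and of its reciprocal -/

/-- If `f` has derivative `g` near `c` except at `c`, and both are continuous at `c`, then `f` has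
derivative `g c` at `c`. -/
theorem hasDerivAt_of_eventually_punctured {f g : ℂ → ℂ} {c : ℂ}
    (h : ∀ᶠ z in 𝓝[≠] c, HasDerivAt f (g z) z) (hf : ContinuousAt f c) (hg : ContinuousAt g c) :
    HasDerivAt f (g c) c := by
  have ha : AnalyticAt ℂ f c := Complex.analyticAt_of_differentiable_on_punctured_nhds_of_continuousAt
    (h.mono fun z hz => hz.differentiableAt) hf
  have h1 : Tendsto (deriv f) (𝓝[≠] c) (𝓝 (deriv f c)) :=
    ha.deriv.continuousAt.tendsto.mono_left nhdsWithin_le_nhds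
  have h2 : Tendsto (deriv f) (𝓝[≠] c) (𝓝 (g c)) :=
    (hg.tendsto.mono_left nhdsWithin_le_nhds).congr' (h.mono fun z hz => hz.deriv.symm)
  rw [tendsto_nhds_unique h2 h1]
  exact ha.differentiableAt.hasDerivAt

namespace PeriodPair

variable (Λ : PeriodPair)

theorem hasDerivAt_weierstrassP {z : ℂ} (hz : z ∉ Λ.lattice) :
    HasDerivAt Λ.weierstrassP (Λ.derivWeierstrassP z) z := by
  rw [← Λ.deriv_weierstrassP]
  exact (Λ.analyticOnNhd_weierstrassP z hz).differentiableAt.hasDerivAt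

theorem tendsto_weierstrassP_cobounded {l : ℂ} (hl : l ∈ Λ.lattice) :
    Tendsto Λ.weierstrassP (𝓝[≠] l) (Bornology.cobounded ℂ) :=
  tendsto_cobounded_of_meromorphicOrderAt_neg (by
    rw [Λ.order_weierstrassP l hl]
    decide)

theorem eventually_notMem_lattice {z : ℂ} (hz : z ∉ Λ.lattice) : ∀ᶠ w in 𝓝 z, w ∉ Λ.lattice :=
  Λ.isClosed_lattice.isOpen_compl.mem_nhds hz

theorem eventually_punctured_notMem_lattice (z : ℂ) : ∀ᶠ w in 𝓝[≠] z, w ∉ Λ.lattice := by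
  filter_upwards [nhdsWithin_le_nhds (Λ.compl_lattice_sdiff_singleton_mem_nhds z),
    self_mem_nhdsWithin] with w hw hwz hwl
  exact hw ⟨hwl, hwz⟩

theorem isPreconnected_compl_lattice : IsPreconnected ((Λ.lattice : Set ℂ)ᶜ) := by
  refine (Set.Countable.isConnected_compl_of_one_lt_rank ?_ ?_).isPreconnected
  · rw [Complex.rank_real_complex]
    norm_num
  · have : Countable Λ.lattice := inferInstance
    exact Set.countable_coe_iff.1 this

theorem exists_notMem_one_lt_norm_weierstrassP :
    ∃ z, z ∉ Λ.lattice ∧ 1 < ‖Λ.weierstrassP z‖ := by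
  have h := Λ.tendsto_weierstrassP_cobounded Λ.lattice.zero_mem
  have h1 := (tendsto_norm_cobounded_atTop.comp h).eventually_gt_atTop 1
  exact ((Λ.eventually_punctured_notMem_lattice 0).and h1).exists

variable {Λ}

/-- The second derivative of `℘`. -/
theorem hasDerivAt_derivWeierstrassP (hΛ : SatisfiesWeierEq Λ) {z : ℂ} (hz : z ∉ Λ.lattice) :
    HasDerivAt Λ.derivWeierstrassP (6 * Λ.weierstrassP z ^ 2 - 8 / 27) z := by
  have han := Λ.analyticOnNhd_derivWeierstrassP
  have key : ∀ w, w ∉ Λ.lattice → Λ.derivWeierstrassP w ≠ 0 →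
      deriv Λ.derivWeierstrassP w = 6 * Λ.weierstrassP w ^ 2 - 8 / 27 := by
    intro w hw hw0
    have h1 := ((han w hw).differentiableAt.hasDerivAt.pow 2)
    have hP := Λ.hasDerivAt_weierstrassP hw
    have h2 := ((hP.pow 3).const_mul 4).sub (hP.const_mul (16 / 27))
    have h3 := (h1.congr_of_eventuallyEq ((Λ.eventually_notMem_lattice hw).mono
      fun v hv => (hΛ v hv).symm)).unique h2
    refine mul_left_cancel₀ (mul_ne_zero two_ne_zero hw0) ?_
    simp at h3
    linear_combination h3
  -- If `℘'` vanished near `z`, it would vanish on the connected complement of the lattice. Then `℘²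
  -- = 4/27` wherever `℘ ≠ 0`, contradicting `|℘| > 1` near the pole.
  have hne : ∀ᶠ w in 𝓝[≠] z, Λ.derivWeierstrassP w ≠ 0 := by
    refine (han z hz).eventually_eq_zero_or_eventually_ne_zero.resolve_left fun h0 => ?_
    have h1 := han.eqOn_zero_of_preconnected_of_eventuallyEq_zero Λ.isPreconnected_compl_lattice
      hz h0
    obtain ⟨w, hw, hw1⟩ := Λ.exists_notMem_one_lt_norm_weierstrassP
    have h2 := hΛ w hw
    rw [h1 hw] at h2
    have h3 : Λ.weierstrassP w ^ 2 = 4 / 27 := by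
      refine mul_left_cancel₀ (mul_ne_zero (by norm_num : (4 : ℂ) ≠ 0)
        (norm_pos_iff.1 (one_pos.trans hw1))) ?_
      simp at h2
      linear_combination -h2
    have h4 := congrArg norm h3
    rw [norm_pow] at h4
    norm_num at h4
    nlinarith
  refine hasDerivAt_of_eventually_punctured
    (g := fun w => 6 * Λ.weierstrassP w ^ 2 - 8 / 27) ?_ (han z hz).continuousAt ?_
  · filter_upwards [hne, nhdsWithin_le_nhds (Λ.eventually_notMem_lattice hz)] with w hw hwl
    rw [← key w hwl hw]
    exact (han w hwl).differentiableAt.hasDerivAt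
  · have := (Λ.analyticOnNhd_weierstrassP z hz).continuousAt
    fun_prop

variable (Λ)

/-- The reciprocal `1 / ℘`, which extends by the value `0` to the lattice points. -/
noncomputable def recipP (z : ℂ) : ℂ := (Λ.weierstrassP z)⁻¹

/-- The function `℘' / ℘²`, which extends by the value `0` to the lattice points. -/
noncomputable def recipPDeriv (z : ℂ) : ℂ := Λ.derivWeierstrassP z * (Λ.weierstrassP z)⁻¹ ^ 2

variable {Λ}

/-- The default value `℘ = 0` at a period gives `1/℘ = 0`, which happens to be the analytic value at
the double pole. -/
theorem recipP_of_mem {l : ℂ} (hl : l ∈ Λ.lattice) : Λ.recipP l = 0 := by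
  simp [recipP, Λ.weierstrassP_coe ⟨l, hl⟩]

theorem recipPDeriv_of_mem {l : ℂ} (hl : l ∈ Λ.lattice) : Λ.recipPDeriv l = 0 := by
  simp [recipPDeriv, Λ.weierstrassP_coe ⟨l, hl⟩]

theorem continuousAt_recipP {l : ℂ} (hl : l ∈ Λ.lattice) : ContinuousAt Λ.recipP l := by
  rw [continuousAt_iff_punctured_nhds, recipP_of_mem hl]
  exact tendsto_inv₀_cobounded.comp (Λ.tendsto_weierstrassP_cobounded hl)

theorem recipPDeriv_sq (hΛ : SatisfiesWeierEq Λ) (z : ℂ) :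
    Λ.recipPDeriv z ^ 2 = 4 * Λ.recipP z - 16 / 27 * Λ.recipP z ^ 3 := by
  by_cases hz : z ∈ Λ.lattice
  · simp [recipP_of_mem hz, recipPDeriv_of_mem hz]
  · rw [recipPDeriv, mul_pow, hΛ z hz, recipP]
    rcases eq_or_ne (Λ.weierstrassP z) 0 with h | h
    · simp [h]
    · field_simp

/-- The square is a polynomial without constant term in `1/℘`, which tends to 0; no Laurent
expansion is needed. -/
theorem continuousAt_recipPDeriv (hΛ : SatisfiesWeierEq Λ) {l : ℂ} (hl : l ∈ Λ.lattice) :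
    ContinuousAt Λ.recipPDeriv l := by
  have h1 : ContinuousAt (fun z => ‖4 * Λ.recipP z - 16 / 27 * Λ.recipP z ^ 3‖) l := by
    have := continuousAt_recipP hl
    fun_prop
  have h2 : ContinuousAt (fun z => ‖Λ.recipPDeriv z‖) l := by
    have := h1.sqrt
    simp_rw [← recipPDeriv_sq hΛ, norm_pow, Real.sqrt_sq (norm_nonneg _)] at this
    exact this
  rw [ContinuousAt, recipPDeriv_of_mem hl, tendsto_zero_iff_norm_tendsto_zero]
  simpa [ContinuousAt, recipPDeriv_of_mem hl] using h2

theorem hasDerivAt_recipP_of_ne {z : ℂ} (hz : z ∉ Λ.lattice) (h0 : Λ.weierstrassP z ≠ 0) :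
    HasDerivAt Λ.recipP (-Λ.recipPDeriv z) z := by
  refine ((Λ.hasDerivAt_weierstrassP hz).inv h0).congr_deriv ?_
  rw [recipPDeriv]
  field_simp

theorem hasDerivAt_recipPDeriv_of_ne (hΛ : SatisfiesWeierEq Λ) {z : ℂ} (hz : z ∉ Λ.lattice)
    (h0 : Λ.weierstrassP z ≠ 0) :
    HasDerivAt Λ.recipPDeriv (-2 + 8 / 9 * Λ.recipP z ^ 2) z := by
  refine ((hasDerivAt_derivWeierstrassP hΛ hz).mul
    (((Λ.hasDerivAt_weierstrassP hz).inv h0).pow 2)).congr_deriv ?_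
  have := hΛ z hz
  rw [recipP]
  simp
  field_simp
  linear_combination (-486) * this

theorem eventually_punctured_ne {l : ℂ} (hl : l ∈ Λ.lattice) :
    ∀ᶠ z in 𝓝[≠] l, z ∉ Λ.lattice ∧ Λ.weierstrassP z ≠ 0 := by
  have h1 := (tendsto_norm_cobounded_atTop.comp
    (Λ.tendsto_weierstrassP_cobounded hl)).eventually_gt_atTop 0
  filter_upwards [Λ.eventually_punctured_notMem_lattice l, h1] with z hz hz1
  exact ⟨hz, norm_pos_iff.1 hz1⟩

/-- At a period the singularity is removable. Zeros of `℘` off the lattice must be excluded: there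
`1/℘` has a true pole. -/
theorem hasDerivAt_recipP {z : ℂ} (h : z ∈ Λ.lattice ∨ Λ.weierstrassP z ≠ 0)
    (hΛ : SatisfiesWeierEq Λ) : HasDerivAt Λ.recipP (-Λ.recipPDeriv z) z := by
  by_cases hz : z ∈ Λ.lattice
  · exact hasDerivAt_of_eventually_punctured (g := fun z => -Λ.recipPDeriv z)
      ((eventually_punctured_ne hz).mono fun w hw => hasDerivAt_recipP_of_ne hw.1 hw.2)
      (continuousAt_recipP hz) (continuousAt_recipPDeriv hΛ hz).neg
  · exact hasDerivAt_recipP_of_ne hz (h.resolve_left hz)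

theorem hasDerivAt_recipPDeriv {z : ℂ} (h : z ∈ Λ.lattice ∨ Λ.weierstrassP z ≠ 0)
    (hΛ : SatisfiesWeierEq Λ) :
    HasDerivAt Λ.recipPDeriv (-2 + 8 / 9 * Λ.recipP z ^ 2) z := by
  by_cases hz : z ∈ Λ.lattice
  · refine hasDerivAt_of_eventually_punctured (g := fun z => -2 + 8 / 9 * Λ.recipP z ^ 2)
      ((eventually_punctured_ne hz).mono fun w hw => hasDerivAt_recipPDeriv_of_ne hΛ hw.1 hw.2)
      (continuousAt_recipPDeriv hΛ hz) ?_
    have := continuousAt_recipP hz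
    fun_prop
  · exact hasDerivAt_recipPDeriv_of_ne hΛ hz (h.resolve_left hz)

end PeriodPair

/-! ### Reality and positivity of `℘` on the real axis -/

namespace PeriodPair

variable {Λ : PeriodPair}

theorem eventually_mem_or_ne {l : ℂ} (hl : l ∈ Λ.lattice) :
    ∀ᶠ z in 𝓝 l, z ∈ Λ.lattice ∨ Λ.weierstrassP z ≠ 0 := by
  have h := eventually_nhdsWithin_iff.1 (eventually_punctured_ne hl)
  filter_upwards [h] with z hz
  rcases eq_or_ne z l with rfl | hzl
  · exact Or.inl hl
  · exact Or.inr (hz hzl).2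

/-- The pair `(1/℘, ℘'/℘²)` and its conjugate solve the same autonomous system with real
coefficients, both starting from `(0, 0)`. -/
theorem eventually_recipP_real (hΛ : SatisfiesWeierEq Λ) :
    ∀ᶠ t : ℝ in 𝓝 0, (starRingEnd ℂ) (Λ.recipP t) = Λ.recipP t := by
  let v : ℂ × ℂ → ℂ × ℂ := fun q => (-q.2, -2 + 8 / 9 * q.1 ^ 2)
  have hv : ContDiff ℝ 1 v := by
    simp only [v]
    fun_prop
  obtain ⟨K, s, hs, hK⟩ := (hv.contDiffAt (x := ((0 : ℂ), (0 : ℂ)))).exists_lipschitzOnWith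
  have hcoe : Tendsto (fun t : ℝ => (t : ℂ)) (𝓝 0) (𝓝 0) := by
    simpa using Complex.continuous_ofReal.tendsto 0
  have hev := hcoe.eventually (eventually_mem_or_ne Λ.lattice.zero_mem)
  have hzero : ((0 : ℝ) : ℂ) ∈ Λ.lattice := by simp
  let f : ℝ → ℂ × ℂ := fun t => (Λ.recipP t, Λ.recipPDeriv t)
  let g : ℝ → ℂ × ℂ := fun t =>
    ((starRingEnd ℂ) (Λ.recipP t), (starRingEnd ℂ) (Λ.recipPDeriv t))
  have hf : ∀ᶠ t in 𝓝 0, HasDerivAt f (v (f t)) t := by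
    filter_upwards [hev] with t ht
    exact (hasDerivAt_recipP ht hΛ).comp_ofReal.prodMk (hasDerivAt_recipPDeriv ht hΛ).comp_ofReal
  have hg : ∀ᶠ t in 𝓝 0, HasDerivAt g (v (g t)) t := by
    filter_upwards [hev] with t ht
    have h1 := (hasDerivAt_recipP ht hΛ).comp_ofReal.star
    have h2 := (hasDerivAt_recipPDeriv ht hΛ).comp_ofReal.star
    refine (h1.prodMk h2).congr_deriv ?_
    simp [v, g]
  have hf0 : f 0 = (0, 0) := by simp only [f, recipP_of_mem hzero, recipPDeriv_of_mem hzero]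
  have hg0 : g 0 = (0, 0) := by
    simp only [g, recipP_of_mem hzero, recipPDeriv_of_mem hzero, map_zero]
  have hfs : ∀ᶠ t in 𝓝 0, f t ∈ s := hf.self_of_nhds.continuousAt (hf0 ▸ hs)
  have hgs : ∀ᶠ t in 𝓝 0, g t ∈ s := hg.self_of_nhds.continuousAt (hg0 ▸ hs)
  have := ODE_solution_unique_of_eventually (v := fun _ => v) (s := fun _ => s)
    (Eventually.of_forall fun _ => hK) (hf.and hfs) (hg.and hgs) (hf0.trans hg0.symm)
  exact this.mono fun t ht => (congrArg Prod.fst ht).symm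

theorem eventually_weierstrassP_im (hΛ : SatisfiesWeierEq Λ) :
    ∀ᶠ t : ℝ in 𝓝 0, (Λ.weierstrassP t).im = 0 := by
  filter_upwards [eventually_recipP_real hΛ] with t ht
  rw [recipP, map_inv₀, inv_inj] at ht
  exact Complex.conj_eq_iff_im.1 ht

theorem hasDerivAt_re_weierstrassP {t : ℝ} (ht : (t : ℂ) ∉ Λ.lattice) :
    HasDerivAt (fun t : ℝ => (Λ.weierstrassP t).re) (Λ.derivWeierstrassP t).re t :=
  (Λ.hasDerivAt_weierstrassP ht).real_of_complex

theorem hasDerivAt_im_weierstrassP {t : ℝ} (ht : (t : ℂ) ∉ Λ.lattice) :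
    HasDerivAt (fun t : ℝ => (Λ.weierstrassP t).im) (Λ.derivWeierstrassP t).im t :=
  Complex.imCLM.hasFDerivAt.comp_hasDerivAt t (Λ.hasDerivAt_weierstrassP ht).comp_ofReal

theorem analyticAt_im_weierstrassP {t : ℝ} (ht : (t : ℂ) ∉ Λ.lattice) :
    AnalyticAt ℝ (fun t : ℝ => (Λ.weierstrassP t).im) t := by
  have h1 : AnalyticAt ℝ Λ.weierstrassP (Complex.ofRealCLM t) :=
    (Λ.analyticOnNhd_weierstrassP _ ht).restrictScalars
  exact (Complex.imCLM.analyticAt _).comp (h1.comp (Complex.ofRealCLM.analyticAt t))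

section Interval

variable {b : ℝ} (hΛ : SatisfiesWeierEq Λ) (hfree : ∀ t ∈ Set.Ioo 0 b, (t : ℂ) ∉ Λ.lattice)
include hΛ hfree

theorem weierstrassP_im_of_mem_Ioo : ∀ t ∈ Set.Ioo 0 b, (Λ.weierstrassP t).im = 0 := by
  intro t ht
  obtain ⟨ε, hε, h⟩ := Metric.eventually_nhds_iff.1 (eventually_weierstrassP_im hΛ)
  have hb : 0 < b := ht.1.trans ht.2
  have hpos : 0 < min ε b := lt_min hε hb
  refine AnalyticOnNhd.eqOn_zero_of_preconnected_of_eventuallyEq_zero (𝕜 := ℝ)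
    (f := fun t : ℝ => (Λ.weierstrassP t).im) (U := Set.Ioo 0 b) (z₀ := min ε b / 2)
    (fun t ht => analyticAt_im_weierstrassP (hfree t ht)) isPreconnected_Ioo
    ⟨by linarith, by linarith [min_le_right ε b]⟩ ?_ ht
  filter_upwards [Ioo_mem_nhds (show (0 : ℝ) < min ε b / 2 by linarith)
    (show min ε b / 2 < ε by linarith [min_le_left ε b])] with s hs
  exact h (by rw [Real.dist_eq, sub_zero, abs_of_pos hs.1]; exact hs.2)

theorem derivWeierstrassP_im_of_mem_Ioo : ∀ t ∈ Set.Ioo 0 b, (Λ.derivWeierstrassP t).im = 0 := by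
  intro t ht
  refine (hasDerivAt_im_weierstrassP (hfree t ht)).unique
    ((hasDerivAt_const t (0 : ℝ)).congr_of_eventuallyEq ?_)
  filter_upwards [Ioo_mem_nhds ht.1 ht.2] with s hs
  exact weierstrassP_im_of_mem_Ioo hΛ hfree s hs

theorem weierstrassP_re_ode_of_mem_Ioo : ∀ t ∈ Set.Ioo 0 b,
    (Λ.derivWeierstrassP t).re ^ 2 =
      4 * (Λ.weierstrassP t).re ^ 3 - 16 / 27 * (Λ.weierstrassP t).re := by
  intro t ht
  have h1 : ((Λ.weierstrassP t).re : ℂ) = Λ.weierstrassP t :=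
    Complex.ext (by simp) (by simp [weierstrassP_im_of_mem_Ioo hΛ hfree t ht])
  have h2 : ((Λ.derivWeierstrassP t).re : ℂ) = Λ.derivWeierstrassP t :=
    Complex.ext (by simp) (by simp [derivWeierstrassP_im_of_mem_Ioo hΛ hfree t ht])
  have := hΛ t (hfree t ht)
  rw [← h1, ← h2] at this
  apply Complex.ofReal_injective
  push_cast
  exact this

/-- For real `p = ℘(t)` the equation forces `p(p² - 4/27) ≥ 0`, which forbids `0 < p < 2/√27`. Near
the pole `p > 1`, and continuity prevents crossing this gap, in which `1/10` lies. -/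
theorem weierstrassP_re_pos_of_mem_Ioo : ∀ t ∈ Set.Ioo 0 b, 0 < (Λ.weierstrassP t).re := by
  intro u hu
  by_contra! hneg
  have hcoe : Tendsto (fun t : ℝ => (t : ℂ)) (𝓝[>] 0) (𝓝[≠] 0) := by
    refine tendsto_nhdsWithin_iff.2 ⟨?_, ?_⟩
    · have : Tendsto (fun t : ℝ => (t : ℂ)) (𝓝 0) (𝓝 0) := by
        simpa using Complex.continuous_ofReal.tendsto 0
      exact this.mono_left nhdsWithin_le_nhds
    · filter_upwards [self_mem_nhdsWithin] with t ht
      have : (0 : ℝ) < t := ht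
      simpa using this.ne'
  have hbig := ((tendsto_norm_cobounded_atTop.comp
    (Λ.tendsto_weierstrassP_cobounded Λ.lattice.zero_mem)).comp hcoe).eventually_gt_atTop 1
  obtain ⟨s, hs1, hs⟩ := (hbig.and (Ioo_mem_nhdsGT hu.1)).exists
  have hsub : Set.Icc s u ⊆ Set.Ioo 0 b := fun t ht =>
    ⟨hs.1.trans_le ht.1, ht.2.trans_lt hu.2⟩
  have hsm := hsub (Set.left_mem_Icc.2 hs.2.le)
  have hcont : ContinuousOn (fun t : ℝ => (Λ.weierstrassP t).re) (Set.Icc s u) := fun t ht =>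
    (hasDerivAt_re_weierstrassP (hfree t (hsub ht))).continuousAt.continuousWithinAt
  have hsre : 1 < |(Λ.weierstrassP s).re| := by
    have h1 : ((Λ.weierstrassP s).re : ℂ) = Λ.weierstrassP s :=
      Complex.ext (by simp) (by simp [weierstrassP_im_of_mem_Ioo hΛ hfree s hsm])
    have h2 : 1 < ‖Λ.weierstrassP s‖ := hs1
    rwa [← h1, Complex.norm_real, Real.norm_eq_abs] at h2
  have hode := weierstrassP_re_ode_of_mem_Ioo hΛ hfree
  have hsbig : 1 < (Λ.weierstrassP s).re := by
    rcases lt_abs.1 hsre with h | h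
    · exact h
    · nlinarith [hode s hsm, sq_nonneg (Λ.derivWeierstrassP s).re,
        sq_nonneg ((Λ.weierstrassP s).re + 1)]
  obtain ⟨c, hc, hc1⟩ := intermediate_value_Icc' hs.2.le hcont
    (show (1 / 10 : ℝ) ∈ _ from ⟨by linarith, by linarith⟩)
  have := hode c (hsub hc)
  simp only at hc1
  rw [hc1] at this
  nlinarith [sq_nonneg (Λ.derivWeierstrassP c).re]

end Interval

/-- On the real axis, `℘` is real and positive and `℘'` is real. -/
theorem weierstrassP_ofReal (hΛ : SatisfiesWeierEq Λ) {u : ℝ} (hu : (u : ℂ) ∉ Λ.lattice) :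
    0 < (Λ.weierstrassP u).re ∧ (Λ.weierstrassP u).im = 0 ∧ (Λ.derivWeierstrassP u).im = 0 := by
  wlog hu0 : 0 ≤ u generalizing u
  · have h := this (u := -u) (by simpa using hu) (by linarith)
    simpa [Λ.weierstrassP_neg, Λ.derivWeierstrassP_neg] using h
  -- Subtracting the largest real period in `[0, u]` moves `u` into an interval starting at 0 and
  -- free of periods; the margin `ε` below makes the point interior.
  let S : Set ℝ := Set.Icc 0 u ∩ (fun t : ℝ => (t : ℂ)) ⁻¹' Λ.lattice
  have hS : IsCompact S :=
    isCompact_Icc.inter_right (Λ.isClosed_lattice.preimage Complex.continuous_ofReal)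
  obtain ⟨l, hl, hmax⟩ := hS.exists_isGreatest ⟨0, ⟨le_rfl, hu0⟩, by simp⟩
  have hlL : (l : ℂ) ∈ Λ.lattice := hl.2
  have hlu : l < u := lt_of_le_of_ne hl.1.2 fun h => hu (h ▸ hl.2)
  obtain ⟨ε, hε, hball⟩ := Metric.eventually_nhds_iff.1
    (Complex.continuous_ofReal.continuousAt.eventually (Λ.eventually_notMem_lattice hu))
  have hfree : ∀ t ∈ Set.Ioo 0 (u - l + ε), (t : ℂ) ∉ Λ.lattice := by
    intro t ht htL
    have h1 : ((t + l : ℝ) : ℂ) ∈ Λ.lattice := by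
      push_cast
      exact Λ.lattice.add_mem htL hlL
    rcases le_or_gt (t + l) u with h | h
    · have := hmax ⟨⟨by linarith [ht.1, hl.1.1], h⟩, h1⟩
      linarith [ht.1]
    · refine hball ?_ h1
      rw [Real.dist_eq, abs_of_pos (by linarith)]
      linarith [ht.2]
  have hmem : u - l ∈ Set.Ioo 0 (u - l + ε) := ⟨by linarith, by linarith⟩
  have e1 : Λ.weierstrassP ((u - l : ℝ) : ℂ) = Λ.weierstrassP u := by
    push_cast
    exact Λ.weierstrassP_sub_coe u ⟨l, hlL⟩
  have e2 : Λ.derivWeierstrassP ((u - l : ℝ) : ℂ) = Λ.derivWeierstrassP u := by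
    push_cast
    exact Λ.derivWeierstrassP_sub_coe u ⟨l, hlL⟩
  rw [← e1, ← e2]
  exact ⟨weierstrassP_re_pos_of_mem_Ioo hΛ hfree _ hmem,
    weierstrassP_im_of_mem_Ioo hΛ hfree _ hmem, derivWeierstrassP_im_of_mem_Ioo hΛ hfree _ hmem⟩

/-- The restriction of `1 / ℘` and `℘' / ℘²` to the real axis. -/
theorem exists_real_recipP (hΛ : SatisfiesWeierEq Λ) : ∃ h k : ℝ → ℝ,
    (∀ t : ℝ, Λ.recipP t = h t) ∧ (∀ t : ℝ, Λ.recipPDeriv t = k t) ∧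
    (∀ t : ℝ, (t : ℂ) ∉ Λ.lattice → 0 < h t) ∧ (∀ t, 0 ≤ h t) ∧
    (∀ t, HasDerivAt h (-k t) t) ∧ (∀ t, HasDerivAt k (-2 + 8 / 9 * h t ^ 2) t) ∧
    (∀ t, k t ^ 2 = 4 * h t - 16 / 27 * h t ^ 3) := by
  have hP : ∀ t : ℝ, (t : ℂ) ∉ Λ.lattice →
      Λ.weierstrassP t = ((Λ.weierstrassP t).re : ℂ) ∧
      Λ.derivWeierstrassP t = ((Λ.derivWeierstrassP t).re : ℂ) := fun t ht =>
    ⟨Complex.ext (by simp) (by simp [(weierstrassP_ofReal hΛ ht).2.1]),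
      Complex.ext (by simp) (by simp [(weierstrassP_ofReal hΛ ht).2.2])⟩
  have hne : ∀ t : ℝ, (t : ℂ) ∈ Λ.lattice ∨ Λ.weierstrassP t ≠ 0 := fun t => by
    by_cases ht : (t : ℂ) ∈ Λ.lattice
    · exact Or.inl ht
    · refine Or.inr fun h0 => ?_
      have := (weierstrassP_ofReal hΛ ht).1
      simp [h0] at this
  have e1 : ∀ t : ℝ, Λ.recipP t = ((Λ.recipP t).re : ℂ) := fun t => by
    by_cases ht : (t : ℂ) ∈ Λ.lattice
    · simp [recipP_of_mem ht]
    · rw [recipP, (hP t ht).1, ← Complex.ofReal_inv, Complex.ofReal_re]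
  have e2 : ∀ t : ℝ, Λ.recipPDeriv t = ((Λ.recipPDeriv t).re : ℂ) := fun t => by
    by_cases ht : (t : ℂ) ∈ Λ.lattice
    · simp [recipPDeriv_of_mem ht]
    · rw [recipPDeriv, (hP t ht).1, (hP t ht).2, ← Complex.ofReal_inv, ← Complex.ofReal_pow,
        ← Complex.ofReal_mul, Complex.ofReal_re]
  have hpos : ∀ t : ℝ, (t : ℂ) ∉ Λ.lattice → 0 < (Λ.recipP t).re := fun t ht => by
    have h1 := inv_pos.2 (weierstrassP_ofReal hΛ ht).1
    rwa [recipP, (hP t ht).1, ← Complex.ofReal_inv, Complex.ofReal_re]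
  refine ⟨fun t => (Λ.recipP t).re, fun t => (Λ.recipPDeriv t).re, e1, e2, hpos, fun t => ?_,
    fun t => ?_, fun t => ?_, fun t => ?_⟩
  · by_cases ht : (t : ℂ) ∈ Λ.lattice
    · simp [recipP_of_mem ht]
    · exact (hpos t ht).le
  · simpa using (hasDerivAt_recipP (hne t) hΛ).real_of_complex
  · refine (hasDerivAt_recipPDeriv (hne t) hΛ).real_of_complex.congr_deriv ?_
    rw [e1 t, show (-2 + 8 / 9 * ((Λ.recipP t).re : ℂ) ^ 2) =
      ((-2 + 8 / 9 * (Λ.recipP t).re ^ 2 : ℝ) : ℂ) by push_cast; ring]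
    simp only [Complex.ofReal_re]
  · have := recipPDeriv_sq hΛ t
    rw [e1, e2] at this
    apply Complex.ofReal_injective
    push_cast
    exact this

end PeriodPair

/-! ### The addition theorem -/

/-- **Addition theorem** in differential form: `T` solves the Weierstrass equation and `h`, `k` are
`1 / ℘` and `℘' / ℘²` for a solution `℘` with a pole at `0`. -/
theorem weierstrass_addition {T S h k : ℝ → ℝ} (hT : ∀ t, HasDerivAt T (S t) t)
    (hS : ∀ t, HasDerivAt S (6 * T t ^ 2 - 8 / 27) t)
    (hTS : ∀ t, S t ^ 2 = 4 * T t ^ 3 - 16 / 27 * T t) (hT0 : ∀ t, T t ≤ 0)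
    (hh : ∀ t, HasDerivAt h (-k t) t) (hk : ∀ t, HasDerivAt k (-2 + 8 / 9 * h t ^ 2) t)
    (hhk : ∀ t, k t ^ 2 = 4 * h t - 16 / 27 * h t ^ 3) (hh0 : ∀ t, 0 ≤ h t)
    (h00 : h 0 = 0) (k00 : k 0 = 0) {r : ℝ} (hr : 0 < h r) :
    T r = 1 / 4 * ((S 0 - k r / h r ^ 2) / (T 0 - 1 / h r)) ^ 2 - T 0 - 1 / h r := by
  -- `N / D²` is the addition formula for `T(t)` and `℘(r - t)`, with both squares of derivatives
  -- eliminated and the fraction cleared of poles. It equals `T r` at `t = r`, where `h` and `k`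
  -- vanish, and the claimed expression at `t = 0`. The signs of `T` and `h` give `D ≥ 1`.
  let N : ℝ → ℝ := fun t => -(4 / 27) * T t * h (r - t) ^ 2 - S t * k (r - t) / 2 -
    4 / 27 * h (r - t) + T t + T t ^ 2 * h (r - t)
  let D : ℝ → ℝ := fun t => 1 - T t * h (r - t)
  have hD : ∀ t, D t ≠ 0 := fun t => by
    have := mul_nonneg (neg_nonneg.2 (hT0 t)) (hh0 (r - t))
    simp only [D]
    nlinarith
  have hη : ∀ t, HasDerivAt (fun t => h (r - t)) (k (r - t)) t := fun t => by
    simpa using (hh (r - t)).comp_const_sub r t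
  have hκ : ∀ t, HasDerivAt (fun t => k (r - t)) (2 - 8 / 9 * h (r - t) ^ 2) t := fun t => by
    refine ((hk (r - t)).comp_const_sub r t).congr_deriv ?_
    ring
  have hN : ∀ t, HasDerivAt N (-(4 / 27) * S t * h (r - t) ^ 2 -
      8 / 27 * T t * h (r - t) * k (r - t) - (6 * T t ^ 2 - 8 / 27) * k (r - t) / 2 -
      S t * (2 - 8 / 9 * h (r - t) ^ 2) / 2 - 4 / 27 * k (r - t) + S t +
      2 * T t * S t * h (r - t) + T t ^ 2 * k (r - t)) t := fun t => by
    refine ((((((hT t).const_mul (-(4 / 27))).mul ((hη t).pow 2)).sub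
      (((hS t).mul (hκ t)).div_const 2)).sub ((hη t).const_mul (4 / 27))).add (hT t)).add
      (((hT t).pow 2).mul (hη t)) |>.congr_deriv ?_
    simp
    ring
  have hD' : ∀ t, HasDerivAt D (-(S t * h (r - t) + T t * k (r - t))) t := fun t =>
    ((hT t).mul (hη t)).const_sub 1
  have hG : ∀ t, HasDerivAt (fun t => N t / D t ^ 2) 0 t := fun t => by
    refine ((hN t).div ((hD' t).pow 2) (pow_ne_zero 2 (hD t))).congr_deriv ?_
    rw [div_eq_zero_iff]
    left
    simp only [N, D]
    simp
    linear_combination (1 - T t * h (r - t)) * (-(k (r - t) * h (r - t)) * hTS t -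
      S t * T t * hhk (r - t))
  have hconst := is_const_of_deriv_eq_zero (fun t => (hG t).differentiableAt)
    (fun t => (hG t).deriv) r 0
  simp only [N, D, sub_self, sub_zero, h00, k00] at hconst
  have hd0 := hD 0
  simp only [D, sub_zero] at hd0
  have hne : T 0 * h r - 1 ≠ 0 := fun h => hd0 (by linarith)
  have h1 : T r = (-(4 / 27) * T 0 * h r ^ 2 - S 0 * k r / 2 - 4 / 27 * h r + T 0 + T 0 ^ 2 * h r) /
      (1 - T 0 * h r) ^ 2 := by simpa using hconst
  rw [h1, show T 0 - 1 / h r = -(1 - T 0 * h r) / h r by field_simp; ring]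
  field_simp
  linear_combination (-54 * h r ^ 4) * hTS 0 - 54 * hhk r

/-! ### Algebra of the invariant curve on the sphere -/

section Sphere

variable {a b c : ℝ}

theorem octSphere_e₂ (h1 : a ^ 2 + b ^ 2 + c ^ 2 = 1) (h2 : a ^ 4 + b ^ 4 + c ^ 4 = 5 / 9) :
    a ^ 2 * b ^ 2 + a ^ 2 * c ^ 2 + b ^ 2 * c ^ 2 = 2 / 9 := by
  linear_combination (1 / 2) * (a ^ 2 + b ^ 2 + c ^ 2 + 1) * h1 - (1 / 2) * h2

theorem octSphere_cubic (h1 : a ^ 2 + b ^ 2 + c ^ 2 = 1) (h2 : a ^ 4 + b ^ 4 + c ^ 4 = 5 / 9) :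
    b ^ 2 * c ^ 2 = (a ^ 2 - 1 / 3) * (a ^ 2 - 2 / 3) := by
  linear_combination octSphere_e₂ h1 h2 - a ^ 2 * h1

/-- This is the discriminant of a cubic with `e₁ = 1` and `e₂ = 2/9`; for these values the two terms
linear in `e₃ = (abc)²` cancel. -/
theorem octSphere_disc (h1 : a ^ 2 + b ^ 2 + c ^ 2 = 1) (h2 : a ^ 4 + b ^ 4 + c ^ 4 = 5 / 9) :
    ((a ^ 2 - b ^ 2) * (a ^ 2 - c ^ 2) * (b ^ 2 - c ^ 2)) ^ 2 =
      4 / 729 - 27 * (a * b * c) ^ 4 := by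
  have e : ((a ^ 2 - b ^ 2) * (a ^ 2 - c ^ 2) * (b ^ 2 - c ^ 2)) ^ 2 =
      (a ^ 2 + b ^ 2 + c ^ 2) ^ 2 * (a ^ 2 * b ^ 2 + a ^ 2 * c ^ 2 + b ^ 2 * c ^ 2) ^ 2 -
      4 * (a ^ 2 * b ^ 2 + a ^ 2 * c ^ 2 + b ^ 2 * c ^ 2) ^ 3 -
      4 * (a ^ 2 + b ^ 2 + c ^ 2) ^ 3 * (a * b * c) ^ 2 +
      18 * (a ^ 2 + b ^ 2 + c ^ 2) * (a ^ 2 * b ^ 2 + a ^ 2 * c ^ 2 + b ^ 2 * c ^ 2) *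
        (a * b * c) ^ 2 - 27 * (a * b * c) ^ 4 := by ring
  rw [e, octSphere_e₂ h1 h2, h1]
  ring

/-- The derivative of the discriminant along the flow, divided by `2 a b c`. -/
theorem octSphere_disc_deriv (h1 : a ^ 2 + b ^ 2 + c ^ 2 = 1)
    (h2 : a ^ 4 + b ^ 4 + c ^ 4 = 5 / 9) :
    (a ^ 2 + b ^ 2 - 2 * c ^ 2) * (a ^ 2 - c ^ 2) * (b ^ 2 - c ^ 2) +
      (a ^ 2 - b ^ 2) * (2 * b ^ 2 - c ^ 2 - a ^ 2) * (b ^ 2 - c ^ 2) +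
      (a ^ 2 - b ^ 2) * (a ^ 2 - c ^ 2) * (b ^ 2 + c ^ 2 - 2 * a ^ 2) = -27 * (a * b * c) ^ 2 := by
  have e : (a ^ 2 + b ^ 2 - 2 * c ^ 2) * (a ^ 2 - c ^ 2) * (b ^ 2 - c ^ 2) +
      (a ^ 2 - b ^ 2) * (2 * b ^ 2 - c ^ 2 - a ^ 2) * (b ^ 2 - c ^ 2) +
      (a ^ 2 - b ^ 2) * (a ^ 2 - c ^ 2) * (b ^ 2 + c ^ 2 - 2 * a ^ 2) =
      -2 * (a ^ 2 + b ^ 2 + c ^ 2) ^ 3 + 9 * (a ^ 2 + b ^ 2 + c ^ 2) *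
        (a ^ 2 * b ^ 2 + a ^ 2 * c ^ 2 + b ^ 2 * c ^ 2) - 27 * (a * b * c) ^ 2 := by ring
  rw [e, octSphere_e₂ h1 h2, h1]
  ring

theorem octK_sphere (h1 : a ^ 2 + b ^ 2 + c ^ 2 = 1) (h2 : a ^ 4 + b ^ 4 + c ^ 4 = 5 / 9) :
    octK a b c = -27 * (a * b * c) ^ 2 := by
  rw [octK, h1, mul_pow, mul_pow, mul_assoc (a ^ 2), octSphere_cubic h1 h2,
    show 2 * a ^ 2 - b ^ 2 - c ^ 2 = 3 * a ^ 2 - 1 by linarith,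
    show a ^ 2 - 2 * b ^ 2 - 2 * c ^ 2 = 3 * a ^ 2 - 2 by linarith]
  ring

/-- The right side is the square of the derivative of `-27(abc)²` along the flow; the cubic relation
and the discriminant make it a function of `a²` alone. -/
theorem octL_sphere (h1 : a ^ 2 + b ^ 2 + c ^ 2 = 1) (h2 : a ^ 4 + b ^ 4 + c ^ 4 = 5 / 9) :
    octL a b c =
      (-54 * (a * b * c) * ((a ^ 2 - b ^ 2) * (a ^ 2 - c ^ 2) * (b ^ 2 - c ^ 2))) ^ 2 := by
  have e : (-54 * (a * b * c) * ((a ^ 2 - b ^ 2) * (a ^ 2 - c ^ 2) * (b ^ 2 - c ^ 2))) ^ 2 =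
      2916 * (a * b * c) ^ 2 *
        ((a ^ 2 - b ^ 2) * (a ^ 2 - c ^ 2) * (b ^ 2 - c ^ 2)) ^ 2 := by ring
  have hbc := octSphere_cubic h1 h2
  rw [e, octSphere_disc h1 h2, show (a * b * c) ^ 4 = (a ^ 2 * (b ^ 2 * c ^ 2)) ^ 2 by ring,
    show (a * b * c) ^ 2 = a ^ 2 * (b ^ 2 * c ^ 2) by ring, hbc, octL, h1,
    show 2 * a ^ 2 - b ^ 2 - c ^ 2 = 3 * a ^ 2 - 1 by linarith,
    show a ^ 2 - 2 * b ^ 2 - 2 * c ^ 2 = 3 * a ^ 2 - 2 by linarith,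
    show b ^ 2 + c ^ 2 + 10 * a ^ 2 = 1 + 9 * a ^ 2 by linarith,
    show 2 * b ^ 2 + 2 * c ^ 2 - 7 * a ^ 2 = 2 - 9 * a ^ 2 by linarith]
  ring

theorem octK_smul {r : ℝ} (hr : r ≠ 0) (a b c : ℝ) :
    octK (r * a) (r * b) (r * c) = octK a b c := by
  have e1 : (r * a) ^ 2 + (r * b) ^ 2 + (r * c) ^ 2 = r ^ 2 * (a ^ 2 + b ^ 2 + c ^ 2) := by ring
  have e2 : -(3 * (r * a) ^ 2 * (2 * (r * a) ^ 2 - (r * b) ^ 2 - (r * c) ^ 2) *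
      ((r * a) ^ 2 - 2 * (r * b) ^ 2 - 2 * (r * c) ^ 2)) = r ^ 6 *
      -(3 * a ^ 2 * (2 * a ^ 2 - b ^ 2 - c ^ 2) * (a ^ 2 - 2 * b ^ 2 - 2 * c ^ 2)) := by ring
  rw [octK, octK, e1, e2, mul_pow, ← pow_mul, mul_div_mul_left _ _ (pow_ne_zero _ hr)]

theorem octL_smul {r : ℝ} (hr : r ≠ 0) (a b c : ℝ) :
    octL (r * a) (r * b) (r * c) = octL a b c := by
  rw [octL, octL, div_mul_eq_mul_div, div_mul_eq_mul_div, div_mul_eq_mul_div, div_mul_eq_mul_div,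
    ← mul_div_mul_left _ (9 * (a ^ 2 + b ^ 2 + c ^ 2) ^ 9) (pow_ne_zero 18 hr)]
  congr 1 <;> ring

end Sphere

/-! ### The Weierstrass equation along an orbit -/

/-- An integral curve of the octahedral field on the part of the unit sphere where
`a⁴ + b⁴ + c⁴ = 5/9`. -/
structure IsOctSphereCurve (a b c : ℝ → ℝ) : Prop where
  deriv_a : ∀ t, HasDerivAt a (b t ^ 3 * c t - b t * c t ^ 3) t
  deriv_b : ∀ t, HasDerivAt b (c t ^ 3 * a t - c t * a t ^ 3) t
  deriv_c : ∀ t, HasDerivAt c (a t ^ 3 * b t - a t * b t ^ 3) t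
  sq : ∀ t, a t ^ 2 + b t ^ 2 + c t ^ 2 = 1
  quartic : ∀ t, a t ^ 4 + b t ^ 4 + c t ^ 4 = 5 / 9

theorem quartic_eq_of_hasDerivAt {a b c : ℝ → ℝ}
    (ha : ∀ t, HasDerivAt a (b t ^ 3 * c t - b t * c t ^ 3) t)
    (hb : ∀ t, HasDerivAt b (c t ^ 3 * a t - c t * a t ^ 3) t)
    (hc : ∀ t, HasDerivAt c (a t ^ 3 * b t - a t * b t ^ 3) t) (t : ℝ) :
    a t ^ 4 + b t ^ 4 + c t ^ 4 = a 0 ^ 4 + b 0 ^ 4 + c 0 ^ 4 := by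
  have hd : ∀ t, HasDerivAt (fun t => a t ^ 4 + b t ^ 4 + c t ^ 4) 0 t := fun t => by
    refine ((((ha t).pow 4).add ((hb t).pow 4)).add ((hc t).pow 4)).congr_deriv ?_
    simp
    ring
  exact is_const_of_deriv_eq_zero (fun t => (hd t).differentiableAt) (fun t => (hd t).deriv) t 0

namespace IsOctSphereCurve

variable {a b c : ℝ → ℝ} (H : IsOctSphereCurve a b c)
include H

theorem hasDerivAt_prod (t : ℝ) : HasDerivAt (fun t => a t * b t * c t)
    ((a t ^ 2 - b t ^ 2) * (a t ^ 2 - c t ^ 2) * (b t ^ 2 - c t ^ 2)) t := by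
  refine (((H.deriv_a t).mul (H.deriv_b t)).mul (H.deriv_c t)).congr_deriv ?_
  simp
  ring

theorem hasDerivAt_T (t : ℝ) : HasDerivAt (fun t => -27 * (a t * b t * c t) ^ 2)
    (-54 * (a t * b t * c t) *
      ((a t ^ 2 - b t ^ 2) * (a t ^ 2 - c t ^ 2) * (b t ^ 2 - c t ^ 2))) t := by
  refine (((H.hasDerivAt_prod t).pow 2).const_mul (-27)).congr_deriv ?_
  simp
  ring

theorem hasDerivAt_disc (t : ℝ) : HasDerivAt
    (fun t => (a t ^ 2 - b t ^ 2) * (a t ^ 2 - c t ^ 2) * (b t ^ 2 - c t ^ 2))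
    (-54 * (a t * b t * c t) ^ 3) t := by
  have hA := (H.deriv_a t).pow 2
  have hB := (H.deriv_b t).pow 2
  have hC := (H.deriv_c t).pow 2
  refine (((hA.sub hB).mul (hA.sub hC)).mul (hB.sub hC)).congr_deriv ?_
  simp
  linear_combination 2 * (a t * b t * c t) * octSphere_disc_deriv (H.sq t) (H.quartic t)

theorem hasDerivAt_S (t : ℝ) : HasDerivAt (fun t => -54 * (a t * b t * c t) *
      ((a t ^ 2 - b t ^ 2) * (a t ^ 2 - c t ^ 2) * (b t ^ 2 - c t ^ 2)))
    (6 * (-27 * (a t * b t * c t) ^ 2) ^ 2 - 8 / 27) t := by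
  refine (((H.hasDerivAt_prod t).const_mul (-54)).mul (H.hasDerivAt_disc t)).congr_deriv ?_
  simp
  linear_combination (-54) * octSphere_disc (H.sq t) (H.quartic t)

theorem S_sq (t : ℝ) : (-54 * (a t * b t * c t) *
      ((a t ^ 2 - b t ^ 2) * (a t ^ 2 - c t ^ 2) * (b t ^ 2 - c t ^ 2))) ^ 2 =
    4 * (-27 * (a t * b t * c t) ^ 2) ^ 3 - 16 / 27 * (-27 * (a t * b t * c t) ^ 2) := by
  linear_combination 2916 * (a t * b t * c t) ^ 2 * octSphere_disc (H.sq t) (H.quartic t)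

/-- By `octSphere_cubic`, `b²c² ≥ 0` forbids `1/3 < a² < 2/3`, so a continuous `a²` cannot pass
through `1/2`. -/
theorem two_thirds_le_sq (h0 : 2 / 3 ≤ a 0 ^ 2) {t : ℝ} (ht : 0 ≤ t) : 2 / 3 ≤ a t ^ 2 := by
  have key : ∀ s, 0 ≤ (a s ^ 2 - 1 / 3) * (a s ^ 2 - 2 / 3) := fun s => by
    rw [← octSphere_cubic (H.sq s) (H.quartic s)]
    positivity
  by_contra! hlt
  have hlt' : a t ^ 2 ≤ 1 / 3 := by nlinarith [key t]
  have hcont : ContinuousOn (fun t => a t ^ 2) (Set.Icc 0 t) := fun s _ =>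
    ((H.deriv_a s).continuousAt.pow 2).continuousWithinAt
  obtain ⟨s, -, hs⟩ := intermediate_value_Icc' ht hcont
    (show (1 / 2 : ℝ) ∈ _ from ⟨by linarith, by linarith⟩)
  have := key s
  simp only at hs
  rw [hs] at this
  norm_num at this

theorem pos (h0 : 2 / 3 ≤ a 0 ^ 2) (ha0 : 0 ≤ a 0) {t : ℝ} (ht : 0 ≤ t) : 0 < a t := by
  by_contra! hle
  have hcont : ContinuousOn a (Set.Icc 0 t) := fun s _ =>
    (H.deriv_a s).continuousAt.continuousWithinAt
  obtain ⟨s, hs, hs0⟩ := intermediate_value_Icc' ht hcont ⟨hle, ha0⟩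
  have := H.two_thirds_le_sq h0 hs.1
  rw [hs0] at this
  norm_num at this

end IsOctSphereCurve

/-! ### Cube roots and Cardano's formula -/

theorem octJ_re (T : ℝ) : (octJ T).re = -108 * T := by simp [octJ]

theorem octJ_im (T : ℝ) : (octJ T).im = 12 * √(12 - 81 * T ^ 2) := by simp [octJ]

theorem norm_octJ {T : ℝ} (hT : 0 ≤ 12 - 81 * T ^ 2) : ‖octJ T‖ = 24 * √3 := by
  have h : ‖octJ T‖ ^ 2 = (24 * √3) ^ 2 := by
    rw [← Complex.normSq_eq_norm_sq, Complex.normSq_apply, octJ_re, octJ_im, mul_pow,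
      Real.sq_sqrt (by norm_num)]
    linear_combination 144 * Real.mul_self_sqrt hT
  exact (sq_eq_sq₀ (norm_nonneg _) (by positivity)).1 h

/-- A complex number with non-negative real part has exactly one cube root of argument at most
`π / 3` in absolute value. -/
theorem existsUnique_cube_root {J : ℂ} (h0 : J ≠ 0) (hre : 0 ≤ J.re) :
    ∃! j : ℂ, j ^ 3 = J ∧ |j.arg| ≤ Real.pi / 3 := by
  have hpow : ∀ (ρ α : ℝ), ((ρ : ℂ) * (Complex.cos α + Complex.sin α * Complex.I)) ^ 3 =
      ((ρ ^ 3 : ℝ) : ℂ) * (Complex.cos ((3 * α : ℝ) : ℂ) +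
        Complex.sin ((3 * α : ℝ) : ℂ) * Complex.I) := fun ρ α => by
    rw [mul_pow, Complex.cos_add_sin_mul_I_pow]
    push_cast
    ring
  have hpi := Real.pi_pos
  have hJarg : |J.arg| ≤ Real.pi / 2 := Complex.abs_arg_le_pi_div_two_iff.2 hre
  have hJ3 := abs_le.1 hJarg
  set ρ : ℝ := ‖J‖ ^ ((3 : ℝ)⁻¹) with hρ
  have hρpos : 0 < ρ := Real.rpow_pos_of_pos (norm_pos_iff.2 h0) _
  have hρ3 : ρ ^ 3 = ‖J‖ := by
    rw [hρ, ← Real.rpow_natCast, ← Real.rpow_mul (norm_nonneg _)]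
    norm_num
  refine ⟨(ρ : ℂ) * (Complex.cos ((J.arg / 3 : ℝ) : ℂ) +
    Complex.sin ((J.arg / 3 : ℝ) : ℂ) * Complex.I), ⟨?_, ?_⟩, ?_⟩
  · rw [hpow, hρ3, mul_div_cancel₀ _ (three_ne_zero' ℝ), Complex.norm_mul_cos_add_sin_mul_I]
  · rw [Complex.arg_mul_cos_add_sin_mul_I hρpos ⟨by linarith, by linarith⟩, abs_le]
    constructor <;> linarith
  · rintro j ⟨hj, hjarg⟩
    have hj0 : j ≠ 0 := by
      rintro rfl
      exact h0 (by rw [← hj]; simp)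
    have hjn : 0 < ‖j‖ := norm_pos_iff.2 hj0
    have hnorm : ‖j‖ = ρ := by
      refine (pow_left_inj₀ hjn.le hρpos.le three_ne_zero).1 ?_
      rw [hρ3, ← hj, norm_pow]
    have hj' : J = ((‖j‖ ^ 3 : ℝ) : ℂ) * (Complex.cos ((3 * j.arg : ℝ) : ℂ) +
        Complex.sin ((3 * j.arg : ℝ) : ℂ) * Complex.I) := by
      rw [← hpow, Complex.norm_mul_cos_add_sin_mul_I, hj]
    have hja := abs_le.1 hjarg
    -- The endpoint `arg j = -π/3` would make `J` a negative real, against `0 ≤ J.re`.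
    have hlt : -Real.pi < 3 * j.arg := by
      refine lt_of_le_of_ne (by linarith) fun he => ?_
      rw [← he] at hj'
      have := congrArg Complex.re hj'
      rw [← Complex.ofReal_cos, ← Complex.ofReal_sin, Real.cos_neg, Real.cos_pi, Real.sin_neg,
        Real.sin_pi] at this
      simp only [neg_zero, Complex.ofReal_zero, zero_mul, add_zero, ← Complex.ofReal_mul,
        Complex.ofReal_re] at this
      have h3 : 0 < ‖j‖ ^ 3 := by positivity
      linarith
    have harg : J.arg = 3 * j.arg := by
      rw [hj', Complex.arg_mul_cos_add_sin_mul_I (by positivity) ⟨hlt, by linarith⟩]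
    rw [harg, mul_div_cancel_left₀ _ (three_ne_zero' ℝ), ← hnorm,
      Complex.norm_mul_cos_add_sin_mul_I]

/-- Cardano's formula for the largest root `A` of `A³ - A² + 2A/9 = -T/27`. -/
theorem cardano_octJ {T A : ℝ} (hT : 0 ≤ 12 - 81 * T ^ 2) (hA : 2 / 3 ≤ A)
    (hAT : T = -27 * (A * ((A - 1 / 3) * (A - 2 / 3)))) {j : ℂ} (hj : j ^ 3 = octJ T)
    (harg : |j.arg| ≤ Real.pi / 3) : (A : ℂ) = j / 18 + 2 / (3 * j) + 1 / 3 := by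
  have hpi := Real.pi_pos
  have h12 : ‖j‖ ^ 2 = 12 := by
    have h3 : (‖j‖ ^ 2) ^ 3 = 12 ^ 3 := by
      rw [← pow_mul, mul_comm, pow_mul, ← norm_pow, hj, norm_octJ hT, mul_pow,
        Real.sq_sqrt (by norm_num)]
      norm_num
    exact (pow_left_inj₀ (by positivity) (by norm_num) three_ne_zero).1 h3
  have hj0 : j ≠ 0 := by
    rintro rfl
    norm_num at h12
  have hre : 0 < j.re := by
    have := Complex.abs_arg_lt_pi_div_two_iff.1 (lt_of_le_of_lt harg (by linarith))
    exact this.resolve_right hj0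
  have hns : j.re * j.re + j.im * j.im = 12 := by
    rw [← Complex.normSq_apply, Complex.normSq_eq_norm_sq, h12]
  have hcube : 4 * j.re ^ 3 - 36 * j.re = -108 * T := by
    rw [← octJ_re, ← hj]
    simp only [pow_succ, pow_zero, one_mul, Complex.mul_re, Complex.mul_im]
    linear_combination (3 * j.re) * hns
  -- Both sides solve `4X³ - 36X = -108T`. The cofactor of their difference is positive because
  -- `j.re > 0` and `9(A - 1/3) ≥ 3`.
  have hAre : j.re = 9 * (A - 1 / 3) := by
    have hz : (j.re - 9 * (A - 1 / 3)) *
        (j.re ^ 2 + j.re * (9 * (A - 1 / 3)) + (9 * (A - 1 / 3)) ^ 2 - 9) = 0 := by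
      rw [hAT] at hcube
      linear_combination hcube / 4
    refine sub_eq_zero.1 ((mul_eq_zero.1 hz).resolve_right (ne_of_gt ?_))
    have h1 : 3 ≤ 9 * (A - 1 / 3) := by linarith
    nlinarith [mul_pos hre (by linarith : 0 < 9 * (A - 1 / 3)), sq_nonneg j.re]
  -- As `|j|² = 12`, the Cardano expression is `j.re / 9 + 1/3`.
  have hconj : 2 / (3 * j) = (starRingEnd ℂ) j / 18 := by
    have hm : j * (starRingEnd ℂ) j = 12 := by
      rw [Complex.mul_conj, Complex.normSq_apply, hns]
      norm_num
    rw [div_eq_div_iff (mul_ne_zero three_ne_zero hj0) (by norm_num)]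
    linear_combination (-3) * hm
  have hadd : j + (starRingEnd ℂ) j = ((2 * j.re : ℝ) : ℂ) := Complex.add_conj j
  rw [hconj, ← add_div, hadd, hAre]
  push_cast
  ring

/-! ### Normalisation and the explicit formula -/

/-- The normalised orbit of a point under the octahedral superflow. -/
theorem IsOctahedralSuperflow.exists_sphereCurve {φ : (Fin 3 → ℝ) → (Fin 3 → ℝ)}
    (hφ : IsOctahedralSuperflow φ) {x y z r : ℝ} (hr : 0 < r) (hsq : x ^ 2 + y ^ 2 + z ^ 2 = r ^ 2)
    (hq : x ^ 4 + y ^ 4 + z ^ 4 = 5 / 9 * r ^ 4) :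
    ∃ a b c : ℝ → ℝ, IsOctSphereCurve a b c ∧ x = r * a 0 ∧ y = r * b 0 ∧ z = r * c 0 ∧
      φ ![x, y, z] 0 = r * a r := by
  obtain ⟨γ, h0, h1, hγ⟩ := hφ.exists_curve ![x, y, z]
  -- Shrinking space by `r` stretches time by `r`, so time 1 on the orbit becomes time `r` on the
  -- unit sphere.
  have hδ := hasDerivAt_smul_curve hγ r⁻¹
  set δ : ℝ → Fin 3 → ℝ := fun s => r⁻¹ • γ (r⁻¹ * s) with hδdef
  have hδ0 : δ 0 = r⁻¹ • ![x, y, z] := by simp [δ, h0]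
  have hx : δ 0 0 = r⁻¹ * x := by simp [hδ0]
  have hy : δ 0 1 = r⁻¹ * y := by simp [hδ0]
  have hz : δ 0 2 = r⁻¹ * z := by simp [hδ0]
  have hlen : ∀ t, sqLen (δ t) = 1 := fun t => by
    have hδ' : ∀ t, HasDerivAt δ ((sqLen (δ t))⁻¹ • octNum (δ t)) t := fun t => by
      rw [← octahedralField_eq]
      exact hδ t
    rw [sqLen_eq_of_hasDerivAt hδ' t, sqLen, hx, hy, hz]
    field_simp
    linarith
  have hN : ∀ t, HasDerivAt δ (octNum (δ t)) t := fun t => by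
    have : HasDerivAt δ (octahedralField (δ t)) t := hδ t
    rwa [octahedralField_eq, hlen, inv_one, one_smul] at this
  have ha : ∀ t, HasDerivAt (fun t => δ t 0) (δ t 1 ^ 3 * δ t 2 - δ t 1 * δ t 2 ^ 3) t :=
    fun t => by simpa [octNum] using hasDerivAt_pi.1 (hN t) 0
  have hb : ∀ t, HasDerivAt (fun t => δ t 1) (δ t 2 ^ 3 * δ t 0 - δ t 2 * δ t 0 ^ 3) t :=
    fun t => by simpa [octNum] using hasDerivAt_pi.1 (hN t) 1
  have hc : ∀ t, HasDerivAt (fun t => δ t 2) (δ t 0 ^ 3 * δ t 1 - δ t 0 * δ t 1 ^ 3) t :=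
    fun t => by simpa [octNum] using hasDerivAt_pi.1 (hN t) 2
  refine ⟨fun t => δ t 0, fun t => δ t 1, fun t => δ t 2, ⟨ha, hb, hc, hlen, fun t => ?_⟩,
    ?_, ?_, ?_, ?_⟩
  · rw [quartic_eq_of_hasDerivAt ha hb hc t, hx, hy, hz]
    field_simp
    linarith
  · simp only [hx]; field_simp
  · simp only [hy]; field_simp
  · simp only [hz]; field_simp
  · simp [δ, hr.ne', h1]

theorem mainTheorem7 :
    -- the octahedral superflow is well defined
    (∃! φ : (Fin 3 → ℝ) → (Fin 3 → ℝ), IsOctahedralSuperflow φ) ∧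
    -- the required Weierstrass function exists, with a square period lattice
    (∃ (ω : ℝ) (Λ : PeriodPair), 0 < ω ∧ Λ.ω₁ = 2 * (ω : ℂ) ∧ Λ.ω₂ = 2 * (ω : ℂ) * Complex.I ∧
      SatisfiesWeierEq Λ) ∧
    -- the explicit formula for the first coordinate of the superflow
    ∀ φ : (Fin 3 → ℝ) → (Fin 3 → ℝ), IsOctahedralSuperflow φ →
    ∀ Λ : PeriodPair, SatisfiesWeierEq Λ →
    ∀ x y z : ℝ, 0 ≤ x → 0 ≤ z → z ≤ y →
      (x ^ 2 + y ^ 2 + z ^ 2) ^ 2 / (x ^ 4 + y ^ 4 + z ^ 4) = 9 / 5 →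
      2 / 3 * (x ^ 2 + y ^ 2 + z ^ 2) ≤ x ^ 2 →
      ((octR x y z : ℝ) : ℂ) ∉ Λ.lattice →
      0 ≤ octL x y z ∧
      ((octK x y z : ℝ) : ℂ) - Λ.weierstrassP (octR x y z : ℝ) ≠ 0 ∧
      ∃ T : ℝ, (T : ℂ) = octT Λ x y z ∧
        0 ≤ 12 - 81 * T ^ 2 ∧
        ‖octJ T‖ = 24 * √3 ∧
        (∃! j : ℂ, j ^ 3 = octJ T ∧ |j.arg| ≤ Real.pi / 3) ∧
        ∀ j : ℂ, j ^ 3 = octJ T → |j.arg| ≤ Real.pi / 3 →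
          ∃ P : ℝ, (P : ℂ) = j / 18 + 2 / (3 * j) + 1 / 3 ∧
            0 < P ∧
            0 < φ ![x, y, z] 0 ∧
            φ ![x, y, z] 0 = √P * √(x ^ 2 + y ^ 2 + z ^ 2) := by
  refine ⟨existsUnique_octahedralSuperflow, exists_square_weierstrass, ?_⟩
  intro φ hφ Λ hΛ x y z hx0 hz0 hzy hratio hx23 hper
  have hquart : x ^ 4 + y ^ 4 + z ^ 4 ≠ 0 := fun h => by
    rw [h] at hratio
    norm_num at hratio
  rw [div_eq_iff hquart] at hratio
  have hρ : 0 < x ^ 2 + y ^ 2 + z ^ 2 := by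
    refine lt_of_le_of_ne (by positivity) fun h => hquart ?_
    rw [← h] at hratio
    linarith
  set r := octR x y z with hr
  have hrpos : 0 < r := Real.sqrt_pos.2 hρ
  have hr2 : x ^ 2 + y ^ 2 + z ^ 2 = r ^ 2 := (Real.sq_sqrt hρ.le).symm
  have hr4 : x ^ 4 + y ^ 4 + z ^ 4 = 5 / 9 * r ^ 4 := by
    rw [hr2] at hratio
    linarith
  obtain ⟨a, b, c, H, hxa, hyb, hzc, hVa⟩ := hφ.exists_sphereCurve hrpos hr2 hr4
  obtain ⟨h, k, hP, hQ, hpos, hnn, hh, hk, hhk⟩ := PeriodPair.exists_real_recipP hΛ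
  -- the initial point
  have ha0 : 0 ≤ a 0 := nonneg_of_mul_nonneg_right (hxa ▸ hx0) hrpos
  have hc0 : 0 ≤ c 0 := nonneg_of_mul_nonneg_right (hzc ▸ hz0) hrpos
  have hcb : c 0 ≤ b 0 := le_of_mul_le_mul_left (hyb ▸ hzc ▸ hzy) hrpos
  have hb0 : 0 ≤ b 0 := hc0.trans hcb
  have ha23 : 2 / 3 ≤ a 0 ^ 2 := by
    rw [hr2, hxa, mul_pow] at hx23
    exact le_of_mul_le_mul_left (by linarith) (pow_pos hrpos 2)
  have hsq0 := H.sq 0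
  let T : ℝ → ℝ := fun t => -27 * (a t * b t * c t) ^ 2
  let S : ℝ → ℝ := fun t => -54 * (a t * b t * c t) *
    ((a t ^ 2 - b t ^ 2) * (a t ^ 2 - c t ^ 2) * (b t ^ 2 - c t ^ 2))
  have hTneg : ∀ t, T t ≤ 0 := fun t => by
    have := sq_nonneg (a t * b t * c t)
    simp only [T]
    linarith
  -- The octant, `a² ≥ 2/3` (hence `b², c² ≤ 1/3`) and `c ≤ b` fix the sign of `T'(0)`, and so the
  -- branch `√L = -T'(0)`.
  have hS0 : S 0 ≤ 0 := by
    have h1 : 0 ≤ a 0 * b 0 * c 0 := by positivity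
    have h2 : 0 ≤ (a 0 ^ 2 - b 0 ^ 2) * (a 0 ^ 2 - c 0 ^ 2) * (b 0 ^ 2 - c 0 ^ 2) :=
      mul_nonneg (mul_nonneg (by nlinarith [sq_nonneg (c 0)]) (by nlinarith [sq_nonneg (b 0)]))
        (by nlinarith)
    have := mul_nonneg h1 h2
    simp only [S]
    linarith
  have hK : octK x y z = T 0 := by
    rw [hxa, hyb, hzc, octK_smul hrpos.ne', octK_sphere (H.sq 0) (H.quartic 0)]
  have hL : octL x y z = S 0 ^ 2 := by
    rw [hxa, hyb, hzc, octL_smul hrpos.ne', octL_sphere (H.sq 0) (H.quartic 0)]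
  have hsqrtL : √(octL x y z) = -S 0 := by
    rw [hL, Real.sqrt_sq_eq_abs, abs_of_nonpos hS0]
  -- the Weierstrass function at `r`
  have hhr : 0 < h r := hpos r hper
  have hhr' : (h r : ℂ) ≠ 0 := by exact_mod_cast hhr.ne'
  have hp : Λ.weierstrassP (r : ℂ) = ((1 / h r : ℝ) : ℂ) := by
    have := hP r
    rw [PeriodPair.recipP] at this
    rw [← inv_inv (Λ.weierstrassP (r : ℂ)), this]
    simp
  have hq : Λ.derivWeierstrassP (r : ℂ) = ((k r / h r ^ 2 : ℝ) : ℂ) := by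
    have h1 := hP r
    have h2 := hQ r
    rw [PeriodPair.recipP] at h1
    rw [PeriodPair.recipPDeriv, h1] at h2
    push_cast
    rw [← h2]
    field_simp
  have hzero : ((0 : ℝ) : ℂ) ∈ Λ.lattice := by simp
  have h00 : h 0 = 0 := by
    have := hP 0
    rw [PeriodPair.recipP_of_mem hzero] at this
    exact_mod_cast this.symm
  have k00 : k 0 = 0 := by
    have := hQ 0
    rw [PeriodPair.recipPDeriv_of_mem hzero] at this
    exact_mod_cast this.symm
  have hadd := weierstrass_addition (T := T) (S := S) H.hasDerivAt_T H.hasDerivAt_S H.S_sq hTneg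
    hh hk hhk hnn h00 k00 hhr
  -- the value at time `r`
  have hA : 2 / 3 ≤ a r ^ 2 := H.two_thirds_le_sq ha23 hrpos.le
  have hapos : 0 < a r := H.pos ha23 ha0 hrpos.le
  have hAT : T r = -27 * (a r ^ 2 * ((a r ^ 2 - 1 / 3) * (a r ^ 2 - 2 / 3))) := by
    rw [← octSphere_cubic (H.sq r) (H.quartic r)]
    simp only [T]
    ring
  have hT12 : 0 ≤ 12 - 81 * T r ^ 2 := by
    have h1 := octSphere_disc (H.sq r) (H.quartic r)
    have h2 := sq_nonneg ((a r ^ 2 - b r ^ 2) * (a r ^ 2 - c r ^ 2) * (b r ^ 2 - c r ^ 2))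
    have h3 : T r ^ 2 = 729 * (a r * b r * c r) ^ 4 := by simp only [T]; ring
    rw [h3]
    linarith
  have hJ := norm_octJ hT12
  refine ⟨by rw [hL]; positivity, ?_, T r, ?_, hT12, hJ, existsUnique_cube_root ?_ ?_, ?_⟩
  · rw [hK, hp, ← Complex.ofReal_sub, Complex.ofReal_ne_zero]
    have := one_div_pos.2 hhr
    have := hTneg 0
    exact ne_of_lt (by linarith)
  · rw [octT, hsqrtL, ← hr, hK, hp, hq, hadd]
    push_cast
    rw [show (-(S 0 : ℂ) + (k r : ℂ) / (h r : ℂ) ^ 2) = -((S 0 : ℂ) - (k r : ℂ) / (h r : ℂ) ^ 2)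
      by ring, neg_div, neg_sq]
  · rw [← norm_pos_iff, hJ]
    positivity
  · rw [octJ_re]
    linarith [hTneg r]
  · intro j hj harg
    refine ⟨a r ^ 2, cardano_octJ hT12 hA hAT hj harg, by positivity, ?_, ?_⟩
    · rw [hVa]
      positivity
    · rw [hVa, Real.sqrt_sq hapos.le, mul_comm]
      rfl
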